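/- Let $F(u)=\tfrac14(u^2-1)^2$, $f(u)=-F'(u)=u-u^3$ and $c_0=\sqrt2\,\big/\int_{-1}^1\sqrt{F(u)}\,du$. For $\delta\in\mathbb R$ let $m_+(\delta)$ and $m_-(\delta)$ be the largest and the smallest zero of $u\mapsto f(u)+\delta$, and let $c(\delta)$ denote the travelling wave speed, i.e. the unique $c\in\mathbb R$ (for those $\delta$, in particular those close to $0$, for which it exists and is unique) such that there is a strictly increasing $m\in C^2(\mathbb R)$ with $$m''+c\,m'+f(m)+\delta=0 \text{ on }\mathbb R,\qquad m(\pm\infty)=m_\pm(\delta).$$ Let $(W(t))_{t\ge0}$ and $(\widetilde W(t))_{t\ge 0}$ be independent standard Brownian motions on a probability space $(\Omega,\mathcal F,\mathbb P)$, and set $W(t)=\widetilde W(-t)$ for $t<0$. Let $\rho:\mathbb R\to[0,\infty)$ be smooth and symmetric, zero outside $[-1,1]$, with $\int\rho=1$; let $0<\gamma<\frac23$ and $1<\beta<2$, and for $\varepsilon>0$ put $$\rho^\varepsilon(x)=\varepsilon^{-\gamma}\rho(x/\varepsilon^{\gamma}),\qquad W^\varepsilon(t)=\int_{\mathbb R}\rho^\varepsilon(t-s)W(s)\,ds,\qquad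 \xi^\varepsilon(t)=\frac{d}{dt}W^\varepsilon(t).$$ Fix $T>0$ and let $$W^{\pm,\varepsilon}(t)=\frac1{c_0}\int_0^t\varepsilon^{-1}c\bigl(\varepsilon\xi^\varepsilon(s)\pm\varepsilon^\beta\bigr)\,ds,\qquad t\in[0,T].$$ Then, almost surely, for both choices of the sign, $W^{\pm,\varepsilon}$ is well defined on $[0,T]$ for all sufficiently small $\varepsilon>0$ (the threshold may depend on $\omega$): $W^\varepsilon$ is differentiable at each $s\in[0,T]$, the speed $c(\varepsilon\xi^\varepsilon(s)\pm\varepsilon^\beta)$ is defined for each $s\in[0,T]$, and the integrand is integrable on $[0,T]$. Moreover, almost surely, for both signs and for every $0\le\alpha<\frac12$, the functions $c_0W^{\pm,\varepsilon}$ converge, as $\varepsilon\downarrow0$, to $t\mapsto -c_0W(t)$ in $C^{0,\alpha}([0,T])$ (that is, in the norm $\|g\|_\infty+\sup_{s\ne t}|g(t)-g(s)|/|t-s|^\alpha$). -/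

import Mathlib

open MeasureTheory ProbabilityTheory Filter Set Topology
open scoped NNReal ENNReal

namespace AllenCahn

noncomputable section

/-! ### The potential, the reaction term and the travelling wave speed -/

/-- The symmetric double-well potential `F(u) = (u² - 1)² / 4`. -/
def potential (u : ℝ) : ℝ := (u ^ 2 - 1) ^ 2 / 4

/-- The reaction term `f = -F'`, i.e. `f(u) = u - u³`. -/
def reaction (u : ℝ) : ℝ := u - u ^ 3

theorem hasDerivAt_potential (u : ℝ) : HasDerivAt potential (-reaction u) u := by
  have h : HasDerivAt potential (2 * (u ^ 2 - 1) * (2 * u) / 4) u := by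
    have h1 : HasDerivAt (fun u : ℝ => u ^ 2 - 1) (2 * u) u := by
      simpa using (hasDerivAt_pow 2 u).sub_const 1
    have h2 := (h1.pow 2).div_const 4
    simp only [Nat.cast_ofNat, Nat.add_one_sub_one, pow_one] at h2
    exact h2
  convert h using 1
  unfold reaction
  ring

/-- The constant `c₀ = √2 / ∫_{-1}^{1} √(F(u)) du`. -/
def c₀ : ℝ := √2 / ∫ u in (-1 : ℝ)..1, √(potential u)

/-- The equilibrium `m₊(δ)`: the largest zero of `u ↦ f(u) + δ`. As long as this cubic has three
distinct zeros (`|δ| < 2 / (3√3)`) it is the smooth branch of zeros through `m₊(0) = 1`. -/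
def mPlus (δ : ℝ) : ℝ := sSup {u : ℝ | reaction u + δ = 0}

/-- The equilibrium `m₋(δ)`: the smallest zero of `u ↦ f(u) + δ`, the branch of zeros through
`m₋(0) = -1`. -/
def mMinus (δ : ℝ) : ℝ := sInf {u : ℝ | reaction u + δ = 0}

/-- `(m, c)` is an increasing travelling wave for the forcing `δ`: a classical solution of
`m'' + c m' + f(m) + δ = 0` on `ℝ` with `m(±∞) = m_±(δ)`. -/
structure IsTravellingWave (δ c : ℝ) (m : ℝ → ℝ) : Prop where
  contDiff : ContDiff ℝ 2 m
  strictMono : StrictMono m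
  ode : ∀ x, deriv (deriv m) x + c * deriv m x + (reaction (m x) + δ) = 0
  tendsto_atTop : Tendsto m atTop (𝓝 (mPlus δ))
  tendsto_atBot : Tendsto m atBot (𝓝 (mMinus δ))

/-- `δ` is admissible when there is exactly one speed `c` of an increasing travelling wave, i.e.
when the wave speed `c(δ)` is well defined. -/
def HasWaveSpeed (δ : ℝ) : Prop := ∃! c : ℝ, ∃ m : ℝ → ℝ, IsTravellingWave δ c m

/-- The travelling wave speed `c(δ)` (meaningful for admissible `δ`, see `HasWaveSpeed`). -/
def waveSpeed (δ : ℝ) : ℝ :=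
  Classical.epsilon fun c : ℝ => ∃ m : ℝ → ℝ, IsTravellingWave δ c m

/-! ### The approximated noise -/

/-- A mollifying kernel: smooth, nonnegative, symmetric, zero outside `[-1, 1]`, of integral 1. -/
structure IsMollifier (ρ : ℝ → ℝ) : Prop where
  smooth : ContDiff ℝ ((⊤ : ℕ∞) : WithTop ℕ∞) ρ
  nonneg : ∀ x, 0 ≤ ρ x
  symm : ∀ x, ρ (-x) = ρ x
  eq_zero : ∀ x, x ∉ Icc (-1 : ℝ) 1 → ρ x = 0
  integral_eq_one : ∫ x, ρ x = 1

/-- The two-sided path which is `b` on `[0, ∞)` and `t ↦ b' (-t)` on `(-∞, 0)`. -/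
def twoSided (b b' : ℝ≥0 → ℝ) (t : ℝ) : ℝ :=
  if 0 ≤ t then b t.toNNReal else b' (-t).toNNReal

/-- The rescaled kernel `ρ^ε(x) = ε^{-γ} ρ(x / ε^γ)`. -/
def scaledKernel (ρ : ℝ → ℝ) (γ ε x : ℝ) : ℝ := ε ^ (-γ) * ρ (x / ε ^ γ)

/-- The mollified path `w^ε(t) = ∫ ρ^ε(t - s) w(s) ds`. -/
def mollified (ρ : ℝ → ℝ) (γ : ℝ) (w : ℝ → ℝ) (ε t : ℝ) : ℝ :=
  ∫ s, scaledKernel ρ γ ε (t - s) * w s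

/-- The noise `ξ^ε`, the time derivative of the mollified path. -/
def noise (ρ : ℝ → ℝ) (γ : ℝ) (w : ℝ → ℝ) (ε t : ℝ) : ℝ := deriv (mollified ρ γ w ε) t

/-- The perturbed argument `ε ξ^ε(s) + σ ε^β` of the wave speed, with sign `σ = ±1`. -/
def forcing (ρ : ℝ → ℝ) (γ β σ : ℝ) (w : ℝ → ℝ) (ε s : ℝ) : ℝ :=
  ε * noise ρ γ w ε s + σ * ε ^ β

/-- `W^{±,ε}(t) = c₀⁻¹ ∫_0^t ε⁻¹ c(ε ξ^ε(s) ± ε^β) ds`, with sign `σ = ±1`. -/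
def Wpm (ρ : ℝ → ℝ) (γ β σ : ℝ) (w : ℝ → ℝ) (ε t : ℝ) : ℝ :=
  1 / c₀ * ∫ s in (0 : ℝ)..t, ε⁻¹ * waveSpeed (forcing ρ γ β σ w ε s)

/-! ### Convergence in Hölder spaces -/

/-- The norm `sup |g| + sup_{s ≠ t} |g(t) - g(s)| / |t - s|^α` of `C^{0,α}([0,T])`, with value `∞`
for functions outside this space. -/
def holderENorm (T : ℝ) (α : ℝ≥0) (g : ℝ → ℝ) : ℝ≥0∞ :=
  (⨆ t : Icc (0 : ℝ) T, ‖g t‖ₑ) + eHolderNorm α (fun t : Icc (0 : ℝ) T => g t)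

/-- `u ε → v` in `C^{0,α}([0,T])` as `ε ↓ 0`: the limit and, for small `ε`, the functions `u ε`
belong to `C^{0,α}([0,T])`, and the norm of the difference tends to `0`. -/
def TendstoHolder (T : ℝ) (α : ℝ≥0) (u : ℝ → ℝ → ℝ) (v : ℝ → ℝ) : Prop :=
  holderENorm T α v < ∞ ∧ (∀ᶠ ε in 𝓝[>] (0 : ℝ), holderENorm T α (u ε) < ∞) ∧
    Tendsto (fun ε => holderENorm T α (fun t => u ε t - v t)) (𝓝[>] 0) (𝓝 0)

end

end AllenCahn

/-!
If `a < b < d` are the zeros of `f + δ`, an explicit logistic profile joining `a` to `d` is a wave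
of speed `c₀ b`. No other speed occurs: the amount by which a wave of speed `c` fails the logistic
equation is a bounded solution of a linear equation with source proportional to `(c - c₀ b) m'`, and
boundedness forces this source to vanish. As `b + δ = b³`, the speed is `c(δ) = -c₀ δ + O(δ³)`.

Since `ε ξ^ε = O(ε^{1-γ})`, replacing the integrand `ε⁻¹ c(ε ξ^ε ± ε^β)` by `-c₀ ξ^ε` costs
`O(ε^{2-3γ} + ε^{β-1})` uniformly in time, which vanishes as `γ < 2/3` and `β > 1`. Thus
`c₀ W^{±,ε} + c₀ W^ε` is, up to an additive constant, small in the Lipschitz norm. Finally `W^ε → W`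
in `C^{0,α}` because, by Kolmogorov's criterion and chaining, Brownian paths are locally `α'`-Hölder
continuous for some `α' > α`.
-/

namespace AllenCahn

/-! ### The travelling wave -/

theorem c₀_eq : c₀ = 3 / √2 := by
  have sqrt_potential : ∀ u ∈ uIcc (-1 : ℝ) 1, √(potential u) = (1 - u ^ 2) / 2 := fun u hu => by
    rw [uIcc_of_le (by norm_num)] at hu
    rw [potential, show (u ^ 2 - 1) ^ 2 / 4 = ((1 - u ^ 2) / 2) ^ 2 by ring]
    exact Real.sqrt_sq (by nlinarith [hu.1, hu.2])
  have integral_eq : ∫ u in (-1 : ℝ)..1, (1 - u ^ 2) / 2 = 2 / 3 := by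
    rw [intervalIntegral.integral_div, intervalIntegral.integral_sub (by simp) (by simp)]
    norm_num [integral_pow]
  have sqrt_two_mul_self : √2 * √2 = 2 := Real.mul_self_sqrt (by norm_num)
  rw [c₀, intervalIntegral.integral_congr sqrt_potential, integral_eq]
  field_simp
  linarith

theorem c₀_pos : 0 < c₀ := by
  rw [c₀_eq]; positivity

/-- `a < b < d` are the zeros of the cubic `f + δ`. -/
structure IsZeroTriple (δ a b d : ℝ) : Prop where
  left_lt : a < b
  lt_right : b < d
  factor : ∀ u, reaction u + δ = (u - a) * (d - u) * (u - b)

/-- The logistic profile: the increasing solution of `m' = (m - a) (d - m) / √2` whose value at `0`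
is the midpoint of `a` and `d`. -/
noncomputable def waveProfile (a d x : ℝ) : ℝ := a + (d - a) * Real.sigmoid ((d - a) / √2 * x)

/-- The amount by which `m` fails the logistic equation solved by `waveProfile a d`. -/
noncomputable def logisticDefect (a d : ℝ) (m : ℝ → ℝ) (x : ℝ) : ℝ :=
  deriv m x - (m x - a) * (d - m x) / √2

section Zeros

variable {δ a b d : ℝ}

theorem IsZeroTriple.reaction_add_eq_zero (h : IsZeroTriple δ a b d) : reaction b + δ = 0 := by
  rw [h.factor, sub_self, mul_zero]

theorem IsZeroTriple.sum_eq_zero (h : IsZeroTriple δ a b d) : a + b + d = 0 := by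
  have h₀ := h.factor 0
  have h₁ := h.factor 1
  have h₂ := h.factor (-1)
  unfold reaction at h₀ h₁ h₂
  linarith

theorem IsZeroTriple.speed_eq (h : IsZeroTriple δ a b d) :
    √2 * (b - (a + d) / 2) = c₀ * b := by
  have hsq : √2 * √2 = 2 := Real.mul_self_sqrt (by norm_num)
  rw [c₀_eq, show a + d = -b by linarith [h.sum_eq_zero]]
  field_simp
  linear_combination b * 3 * hsq

theorem IsZeroTriple.setOf_reaction_add_eq_zero (h : IsZeroTriple δ a b d) :
    {u : ℝ | reaction u + δ = 0} = {a, b, d} := by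
  ext u
  simp only [mem_ofPred_eq, h.factor, mul_eq_zero, sub_eq_zero, mem_insert_iff,
    mem_singleton_iff, eq_comm (a := d)]
  tauto

theorem IsZeroTriple.mPlus_eq (h : IsZeroTriple δ a b d) : mPlus δ = d := by
  rw [mPlus, h.setOf_reaction_add_eq_zero]
  refine IsGreatest.csSup_eq ⟨by simp, ?_⟩
  rintro u (rfl | rfl | rfl) <;> linarith [h.left_lt, h.lt_right]

theorem IsZeroTriple.mMinus_eq (h : IsZeroTriple δ a b d) : mMinus δ = a := by
  rw [mMinus, h.setOf_reaction_add_eq_zero]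
  refine IsLeast.csInf_eq ⟨by simp, ?_⟩
  rintro u (rfl | rfl | rfl) <;> linarith [h.left_lt, h.lt_right]

theorem exists_reaction_add_eq_zero {δ : ℝ} (hδ : |δ| ≤ 3 / 8) :
    ∃ b, |b| ≤ 1 / 2 ∧ reaction b + δ = 0 := by
  have hc : ContinuousOn reaction (Icc (-1 / 2) (1 / 2)) := by
    unfold reaction; fun_prop
  have hmem : -δ ∈ Icc (reaction (-1 / 2)) (reaction (1 / 2)) := by
    unfold reaction
    constructor <;> linarith [abs_le.1 hδ]
  obtain ⟨b, hb, hbδ⟩ := intermediate_value_Icc (by norm_num) hc hmem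
  exact ⟨b, abs_le.2 ⟨by linarith [hb.1], hb.2⟩, by linarith⟩

theorem exists_isZeroTriple_of_reaction_add_eq_zero (hb : |b| ≤ 1 / 2)
    (hδ : reaction b + δ = 0) : ∃ a d, IsZeroTriple δ a b d := by
  have hb2 : b ^ 2 ≤ 1 / 4 := by
    have := sq_le_sq' (abs_le.1 hb).1 (abs_le.1 hb).2
    linarith
  set s := √(4 - 3 * b ^ 2)
  have hss : s * s = 4 - 3 * b ^ 2 := Real.mul_self_sqrt (by linarith)
  have h3 : |3 * b| < s := abs_lt_of_sq_lt_sq (by nlinarith) (Real.sqrt_nonneg _)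
  refine ⟨(-b - s) / 2, (-b + s) / 2, by linarith [(abs_lt.1 h3).1],
    by linarith [(abs_lt.1 h3).2], fun u => ?_⟩
  unfold reaction at hδ ⊢
  linear_combination (-(u - b) / 4) * hss + hδ

theorem exists_isZeroTriple {δ : ℝ} (hδ : |δ| ≤ 3 / 8) :
    ∃ a b d, |b| ≤ 1 / 2 ∧ IsZeroTriple δ a b d := by
  obtain ⟨b, hb, hbδ⟩ := exists_reaction_add_eq_zero hδ
  obtain ⟨a, d, h⟩ := exists_isZeroTriple_of_reaction_add_eq_zero hb hbδ
  exact ⟨a, b, d, hb, h⟩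

end Zeros

section Profile

variable {δ a b d : ℝ}

theorem hasDerivAt_waveProfile (a d x : ℝ) :
    HasDerivAt (waveProfile a d)
      ((waveProfile a d x - a) * (d - waveProfile a d x) / √2) x := by
  have hlin : HasDerivAt (fun x : ℝ => (d - a) / √2 * x) ((d - a) / √2) x := by
    simpa using (hasDerivAt_id x).const_mul ((d - a) / √2)
  convert! (((Real.hasDerivAt_sigmoid ((d - a) / √2 * x)).comp x hlin).const_mul
    (d - a)).const_add a using 1
  unfold waveProfile
  ring

theorem deriv_waveProfile (a d : ℝ) :
    deriv (waveProfile a d) = fun x => (waveProfile a d x - a) * (d - waveProfile a d x) / √2 :=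
  funext fun x => (hasDerivAt_waveProfile a d x).deriv

theorem contDiff_waveProfile (a d : ℝ) {n : WithTop ℕ∞} : ContDiff ℝ n (waveProfile a d) := by
  have hsigmoid : ContDiff ℝ n Real.sigmoid := contDiff_sigmoid.of_le le_top
  unfold waveProfile
  fun_prop

theorem strictMono_waveProfile (had : a < d) : StrictMono (waveProfile a d) := fun x y hxy => by
  have : 0 < d - a := sub_pos.2 had
  have : 0 < (d - a) / √2 := by positivity
  unfold waveProfile
  gcongr

theorem tendsto_waveProfile_atTop (had : a < d) : Tendsto (waveProfile a d) atTop (𝓝 d) := by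
  have : 0 < d - a := sub_pos.2 had
  have hlin : Tendsto (fun x : ℝ => (d - a) / √2 * x) atTop atTop :=
    tendsto_id.const_mul_atTop (by positivity)
  simpa [waveProfile, Function.comp_def] using!
    ((Real.tendsto_sigmoid_atTop.comp hlin).const_mul (d - a)).const_add a

theorem tendsto_waveProfile_atBot (had : a < d) : Tendsto (waveProfile a d) atBot (𝓝 a) := by
  have : 0 < d - a := sub_pos.2 had
  have hlin : Tendsto (fun x : ℝ => (d - a) / √2 * x) atBot atBot :=
    tendsto_id.const_mul_atBot (by positivity)
  simpa [waveProfile, Function.comp_def] using!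
    ((Real.tendsto_sigmoid_atBot.comp hlin).const_mul (d - a)).const_add a

theorem IsZeroTriple.ode_waveProfile (h : IsZeroTriple δ a b d) (x : ℝ) :
    deriv (deriv (waveProfile a d)) x + c₀ * b * deriv (waveProfile a d) x +
      (reaction (waveProfile a d x) + δ) = 0 := by
  have hm := hasDerivAt_waveProfile a d x
  have hm' := (((hm.sub_const a).mul (hm.const_sub d)).div_const √2).deriv
  simp only [Pi.mul_apply] at hm'
  have hsq : √2 * √2 = 2 := Real.mul_self_sqrt (by norm_num)
  rw [deriv_waveProfile, hm', h.factor, ← h.speed_eq]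
  field_simp
  rw [pow_two, hsq]
  ring

theorem IsZeroTriple.isTravellingWave_waveProfile (h : IsZeroTriple δ a b d) :
    IsTravellingWave δ (c₀ * b) (waveProfile a d) where
  contDiff := contDiff_waveProfile a d
  strictMono := strictMono_waveProfile (h.left_lt.trans h.lt_right)
  ode := h.ode_waveProfile
  tendsto_atTop := by
    simpa only [h.mPlus_eq] using tendsto_waveProfile_atTop (h.left_lt.trans h.lt_right)
  tendsto_atBot := by
    simpa only [h.mMinus_eq] using tendsto_waveProfile_atBot (h.left_lt.trans h.lt_right)

end Profile

section LinearODE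

theorem tendsto_atTop_of_deriv_tendsto_pos {G g : ℝ → ℝ} {l : ℝ} (hl : 0 < l)
    (hG : ∀ x, HasDerivAt G (g x) x) (hg : Tendsto g atTop (𝓝 l)) : Tendsto G atTop atTop := by
  obtain ⟨x₀, hx₀⟩ := eventually_atTop.1 (hg.eventually (lt_mem_nhds (half_lt_self hl)))
  have hd : ∀ x, HasDerivAt (fun x => G x - l / 2 * x) (g x - l / 2) x := fun x => by
    simpa using! (hG x).sub ((hasDerivAt_id x).const_mul (l / 2))
  have hmono : MonotoneOn (fun x => G x - l / 2 * x) (Ici x₀) := by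
    refine monotoneOn_of_hasDerivWithinAt_nonneg (convex_Ici x₀)
      (fun x _ => (hd x).continuousAt.continuousWithinAt)
      (fun x _ => (hd x).hasDerivWithinAt) fun x hx => ?_
    rw [interior_Ici] at hx
    linarith [hx₀ x hx.le]
  have hline : Tendsto (fun x => l / 2 * x + (G x₀ - l / 2 * x₀)) atTop atTop :=
    tendsto_atTop_add_const_right _ _ (tendsto_id.const_mul_atTop (by positivity))
  refine tendsto_atTop_mono' atTop ?_ hline
  filter_upwards [eventually_ge_atTop x₀] with x hx
  have := hmono self_mem_Ici hx hx
  simp only at this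
  linarith

theorem tendsto_atBot_atTop_of_deriv_tendsto_neg {G g : ℝ → ℝ} {l : ℝ} (hl : l < 0)
    (hG : ∀ x, HasDerivAt G (g x) x) (hg : Tendsto g atBot (𝓝 l)) : Tendsto G atBot atTop := by
  have hreflect := tendsto_atTop_of_deriv_tendsto_pos (neg_pos.2 hl)
    (fun x => by simpa using! (hG (-x)).scomp x (hasDerivAt_neg x))
    (hg.comp tendsto_neg_atTop_atBot).neg
  simpa [Function.comp_def] using hreflect.comp tendsto_neg_atBot_atTop

theorem exists_antideriv_tendsto_atTop {κ : ℝ → ℝ} {p n : ℝ} (hκ : Continuous κ) (hp : 0 < p)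
    (hn : n < 0) (htop : Tendsto κ atTop (𝓝 p)) (hbot : Tendsto κ atBot (𝓝 n)) :
    ∃ G : ℝ → ℝ, (∀ x, HasDerivAt G (κ x) x) ∧ Tendsto G atTop atTop ∧ Tendsto G atBot atTop := by
  have hG : ∀ x, HasDerivAt (fun x => ∫ y in (0 : ℝ)..x, κ y) (κ x) x := fun x =>
    intervalIntegral.integral_hasDerivAt_right (hκ.intervalIntegrable _ _)
      (hκ.stronglyMeasurableAtFilter _ _) hκ.continuousAt
  exact ⟨_, hG, tendsto_atTop_of_deriv_tendsto_pos hp hG htop,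
    tendsto_atBot_atTop_of_deriv_tendsto_neg hn hG hbot⟩

theorem tendsto_mul_exp_neg_nhds_zero {v G : ℝ → ℝ} {N : ℝ} {l : Filter ℝ}
    (hv : ∀ x, |v x| ≤ N) (hG : Tendsto G l atTop) :
    Tendsto (fun x => v x * Real.exp (-G x)) l (𝓝 0) :=
  bdd_le_mul_tendsto_zero' N (Eventually.of_forall hv)
    (Real.tendsto_exp_neg_atTop_nhds_zero.comp hG)

/-- Multiplying by the integrating factor `exp (-∫ κ)`, which vanishes at `±∞`, turns `v` into a
monotone function vanishing at `±∞`. -/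
theorem eq_zero_of_bounded_of_hasDerivAt {v κ s : ℝ → ℝ} {p n N : ℝ} (hκ : Continuous κ)
    (hp : 0 < p) (hn : n < 0) (htop : Tendsto κ atTop (𝓝 p)) (hbot : Tendsto κ atBot (𝓝 n))
    (hN : ∀ x, |v x| ≤ N) (hv : ∀ x, HasDerivAt v (κ x * v x + s x) x) (hs : ∀ x, 0 ≤ s x)
    (x : ℝ) : s x = 0 := by
  obtain ⟨G, hG, hGtop, hGbot⟩ := exists_antideriv_tendsto_atTop hκ hp hn htop hbot
  have hder : ∀ x, HasDerivAt (fun x => v x * Real.exp (-G x)) (s x * Real.exp (-G x)) x :=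
    fun x => by
      convert! (hv x).mul (hG x).neg.exp using 1
      simp only [Pi.neg_apply]
      ring
  have hmono : Monotone fun x => v x * Real.exp (-G x) :=
    monotone_of_hasDerivAt_nonneg hder fun x => mul_nonneg (hs x) (Real.exp_pos _).le
  have hzero : ∀ x, v x * Real.exp (-G x) = 0 := fun x =>
    le_antisymm (hmono.ge_of_tendsto (tendsto_mul_exp_neg_nhds_zero hN hGtop) x)
      (hmono.le_of_tendsto (tendsto_mul_exp_neg_nhds_zero hN hGbot) x)
  have hconst := hder x
  simp only [hzero] at hconst
  exact (mul_eq_zero.1 (hconst.unique (hasDerivAt_const x 0))).resolve_right (Real.exp_pos _).ne'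

/-- The quantity `p + c m` has derivative `g`, and `p` is at most `D` somewhere within distance `1`
by the mean value theorem. -/
theorem abs_le_of_hasDerivAt_damped {m p g : ℝ → ℝ} {c D K : ℝ}
    (hm : ∀ x, HasDerivAt m (p x) x) (hp : ∀ x, HasDerivAt p (g x - c * p x) x)
    (hD : ∀ x y, |m x - m y| ≤ D) (hK : ∀ x, |g x| ≤ K) (x : ℝ) :
    |p x| ≤ D + (K + |c| * D) := by
  have hsum : ∀ z, HasDerivAt (fun x => p x + c * m x) (g z) z := fun z => by
    convert! (hp z).add ((hm z).const_mul c) using 1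
    ring
  obtain ⟨y, hy, hslope⟩ := exists_hasDerivAt_eq_slope m p (lt_add_one x)
    (fun z _ => (hm z).continuousAt.continuousWithinAt) fun z _ => hm z
  rw [add_sub_cancel_left, div_one] at hslope
  have hpy : |p y| ≤ D := hslope ▸ hD _ _
  have hxy : |x - y| ≤ 1 := abs_le.2 ⟨by linarith [hy.2], by linarith [hy.1]⟩
  have hlip : |(p x + c * m x) - (p y + c * m y)| ≤ K := by
    refine (convex_univ.norm_image_sub_le_of_norm_hasDerivWithin_le
      (fun z _ => (hsum z).hasDerivWithinAt) (fun z _ => hK z) (mem_univ y) (mem_univ x)).trans ?_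
    exact mul_le_of_le_one_right ((abs_nonneg _).trans (hK x)) hxy
  have hcm : |c * (m y - m x)| ≤ |c| * D := by
    rw [abs_mul]; gcongr; exact hD y x
  calc |p x| = |p y + (((p x + c * m x) - (p y + c * m y)) + c * (m y - m x))| := by
        congr 1; ring
    _ ≤ |p y| + (|(p x + c * m x) - (p y + c * m y)| + |c * (m y - m x)|) :=
        (abs_add_le _ _).trans (by gcongr; exact abs_add_le _ _)
    _ ≤ D + (K + |c| * D) := by gcongr

end LinearODE

namespace IsTravellingWave

variable {δ a b c d : ℝ} {m : ℝ → ℝ}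

theorem mem_Icc (h : IsTravellingWave δ c m) (x : ℝ) : m x ∈ Icc (mMinus δ) (mPlus δ) :=
  ⟨h.strictMono.monotone.le_of_tendsto h.tendsto_atBot x,
    h.strictMono.monotone.ge_of_tendsto h.tendsto_atTop x⟩

theorem hasDerivAt (h : IsTravellingWave δ c m) (x : ℝ) : HasDerivAt m (deriv m x) x :=
  (h.contDiff.differentiable (by norm_num)).differentiableAt.hasDerivAt

theorem hasDerivAt_deriv (h : IsTravellingWave δ c m) (x : ℝ) :
    HasDerivAt (deriv m) (-(reaction (m x) + δ) - c * deriv m x) x := by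
  have hdiff : Differentiable ℝ (deriv m) :=
    (contDiff_succ_iff_deriv.1 (show ContDiff ℝ (1 + 1) m from h.contDiff)).2.2.differentiable
      one_ne_zero
  exact (hdiff x).hasDerivAt.congr_deriv (by linarith [h.ode x])

theorem exists_abs_deriv_le (h : IsTravellingWave δ c m) : ∃ M, ∀ x, |deriv m x| ≤ M := by
  have hcont : ContinuousOn (fun u => -(reaction u + δ)) (Icc (mMinus δ) (mPlus δ)) := by
    unfold reaction; fun_prop
  obtain ⟨K, hK⟩ := isCompact_Icc.exists_bound_of_continuousOn hcont
  exact ⟨_, abs_le_of_hasDerivAt_damped h.hasDerivAt h.hasDerivAt_deriv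
    (fun x y => Real.dist_le_of_mem_Icc (h.mem_Icc x) (h.mem_Icc y)) fun x => hK _ (h.mem_Icc x)⟩

theorem exists_abs_logisticDefect_le (h : IsTravellingWave δ c m) (a d : ℝ) :
    ∃ N, ∀ x, |logisticDefect a d m x| ≤ N := by
  obtain ⟨M, hM⟩ := h.exists_abs_deriv_le
  have hcont : ContinuousOn (fun u => (u - a) * (d - u) / √2) (Icc (mMinus δ) (mPlus δ)) := by
    fun_prop
  obtain ⟨K, hK⟩ := isCompact_Icc.exists_bound_of_continuousOn hcont
  exact ⟨M + K, fun x => (abs_sub _ _).trans (add_le_add (hM x) (hK _ (h.mem_Icc x)))⟩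

theorem hasDerivAt_logisticDefect (h : IsTravellingWave δ c m) (hz : IsZeroTriple δ a b d) (x : ℝ) :
    HasDerivAt (logisticDefect a d m)
      (√2 * (m x - b) * logisticDefect a d m x - (c - c₀ * b) * deriv m x) x := by
  have hsq : √2 * √2 = 2 := Real.mul_self_sqrt (by norm_num)
  convert! (h.hasDerivAt_deriv x).sub
    ((((h.hasDerivAt x).sub_const a).mul ((h.hasDerivAt x).const_sub d)).div_const √2) using 1
  rw [← hz.speed_eq, hz.factor, logisticDefect]
  field_simp
  linear_combination (2 * (m x - b) * deriv m x + (b * 2 - (a + d)) * deriv m x) * hsq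

/-- With `v` the defect and `e = c - c₀ b`, the function `-e v` solves a linear equation with source
`e² m' ≥ 0` and so `e² m' = 0`. -/
theorem speed_eq (h : IsTravellingWave δ c m) (hz : IsZeroTriple δ a b d) : c = c₀ * b := by
  have hs0 : 0 < √2 := by positivity
  obtain ⟨N, hN⟩ := h.exists_abs_logisticDefect_le a d
  have htop := ((hz.mPlus_eq ▸ h.tendsto_atTop).sub_const b).const_mul √2
  have hbot := ((hz.mMinus_eq ▸ h.tendsto_atBot).sub_const b).const_mul √2
  have hcont : Continuous fun x => √2 * (m x - b) := by
    have := h.contDiff.continuous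
    fun_prop
  have hsource : ∀ x, (c - c₀ * b) ^ 2 * deriv m x = 0 := by
    refine eq_zero_of_bounded_of_hasDerivAt (N := |-(c - c₀ * b)| * N)
      (v := fun x => -(c - c₀ * b) * logisticDefect a d m x) hcont
      (mul_pos hs0 (sub_pos.2 hz.lt_right)) (mul_neg_of_pos_of_neg hs0 (sub_neg.2 hz.left_lt))
      htop hbot (fun x => ?_) (fun x => ?_)
      fun x => mul_nonneg (sq_nonneg _) h.strictMono.monotone.deriv_nonneg
    · rw [abs_mul]
      gcongr
      exact hN x
    · exact ((h.hasDerivAt_logisticDefect hz x).const_mul _).congr_deriv (by ring)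
  by_contra hne
  have hderiv : ∀ x, deriv m x = 0 := fun x =>
    (mul_eq_zero.1 (hsource x)).resolve_left (pow_ne_zero 2 (sub_ne_zero.2 hne))
  exact (h.strictMono zero_lt_one).ne
    (is_const_of_deriv_eq_zero (fun x => (h.hasDerivAt x).differentiableAt) hderiv 0 1)

end IsTravellingWave

section Speed

variable {δ a b d : ℝ}

theorem IsZeroTriple.hasWaveSpeed (h : IsZeroTriple δ a b d) : HasWaveSpeed δ :=
  ⟨c₀ * b, ⟨_, h.isTravellingWave_waveProfile⟩, fun _ ⟨_, hm⟩ => hm.speed_eq h⟩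

theorem IsZeroTriple.waveSpeed_eq (h : IsZeroTriple δ a b d) : waveSpeed δ = c₀ * b := by
  obtain ⟨m, hm⟩ := Classical.epsilon_spec (p := fun c : ℝ => ∃ m, IsTravellingWave δ c m)
    ⟨_, _, h.isTravellingWave_waveProfile⟩
  exact hm.speed_eq h

theorem hasWaveSpeed_of_abs_le (hδ : |δ| ≤ 3 / 8) : HasWaveSpeed δ := by
  obtain ⟨_, _, _, _, h⟩ := exists_isZeroTriple hδ
  exact h.hasWaveSpeed

/-- The middle zero `b` of `f + δ` satisfies `b + δ = b³`. -/
theorem abs_waveSpeed_add_le (hδ : |δ| ≤ 3 / 8) :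
    |waveSpeed δ + c₀ * δ| ≤ 3 * c₀ * |δ| ^ 3 := by
  obtain ⟨a, b, d, hb, h⟩ := exists_isZeroTriple hδ
  have hδb : δ = -(b * (1 - b ^ 2)) := by
    have := h.reaction_add_eq_zero
    unfold reaction at this
    linarith
  have hb2 : b ^ 2 ≤ 1 / 4 := by
    have := sq_le_sq' (abs_le.1 hb).1 (abs_le.1 hb).2
    linarith
  have hbδ : |b| ≤ 4 / 3 * |δ| := by
    rw [hδb, abs_neg, abs_mul, abs_of_nonneg (by linarith : 0 ≤ 1 - b ^ 2)]
    nlinarith [abs_nonneg b]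
  calc |waveSpeed δ + c₀ * δ| = c₀ * |b| ^ 3 := by
        rw [h.waveSpeed_eq, show c₀ * b + c₀ * δ = c₀ * b ^ 3 by rw [hδb]; ring, abs_mul,
          abs_of_pos c₀_pos, abs_pow]
    _ ≤ c₀ * (4 / 3 * |δ|) ^ 3 := by have := c₀_pos; gcongr
    _ ≤ 3 * c₀ * |δ| ^ 3 := by nlinarith [mul_nonneg c₀_pos.le (pow_nonneg (abs_nonneg δ) 3)]

theorem abs_sub_le_of_reaction_sub {p q : ℝ} (hp : |p| ≤ 1 / 2) (hq : |q| ≤ 1 / 2) :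
    |p - q| ≤ 4 * |reaction p - reaction q| := by
  have hfac : reaction p - reaction q = (p - q) * (1 - (p ^ 2 + p * q + q ^ 2)) := by
    unfold reaction; ring
  have hslope : 1 / 4 ≤ 1 - (p ^ 2 + p * q + q ^ 2) := by
    have := sq_le_sq' (abs_le.1 hp).1 (abs_le.1 hp).2
    have := sq_le_sq' (abs_le.1 hq).1 (abs_le.1 hq).2
    nlinarith [sq_nonneg (p - q)]
  rw [hfac, abs_mul, abs_of_nonneg (by linarith : 0 ≤ 1 - (p ^ 2 + p * q + q ^ 2))]
  nlinarith [abs_nonneg (p - q)]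

theorem lipschitzOnWith_waveSpeed :
    LipschitzOnWith (4 * c₀).toNNReal waveSpeed {δ | |δ| ≤ 3 / 8} := by
  refine LipschitzOnWith.of_dist_le_mul fun x hx y hy => ?_
  obtain ⟨_, p, _, hp, hxp⟩ := exists_isZeroTriple hx
  obtain ⟨_, q, _, hq, hyq⟩ := exists_isZeroTriple hy
  have hc := c₀_pos
  have hxy : reaction p - reaction q = -(x - y) := by
    linarith [hxp.reaction_add_eq_zero, hyq.reaction_add_eq_zero]
  calc dist (waveSpeed x) (waveSpeed y) = c₀ * |p - q| := by
        rw [hxp.waveSpeed_eq, hyq.waveSpeed_eq, Real.dist_eq, ← mul_sub, abs_mul, abs_of_pos hc]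
    _ ≤ c₀ * (4 * |x - y|) := by
        gcongr
        simpa only [hxy, abs_neg] using abs_sub_le_of_reaction_sub hp hq
    _ = (4 * c₀).toNNReal * dist x y := by
        rw [Real.coe_toNNReal _ (by positivity), Real.dist_eq]; ring

end Speed

/-! ### Hölder continuity -/

section Holder

variable {X : Type*} [PseudoMetricSpace X] {S : Set X} {α C D : ℝ≥0} {f g : X → ℝ}

theorem holderOnWith_of_dist_le {Y : Type*} [PseudoMetricSpace Y] {f : X → Y} {K : ℝ}
    (h : ∀ x ∈ S, ∀ y ∈ S, dist (f x) (f y) ≤ K * dist x y ^ (α : ℝ)) :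
    HolderOnWith K.toNNReal α f S := fun x hx y hy => by
  rw [edist_dist, edist_dist, ENNReal.ofReal_rpow_of_nonneg dist_nonneg α.coe_nonneg,
    ← ENNReal.ofReal_coe_nnreal, ← ENNReal.ofReal_mul (NNReal.coe_nonneg _)]
  refine ENNReal.ofReal_le_ofReal ((h x hx y hy).trans ?_)
  gcongr
  exact Real.le_coe_toNNReal K

theorem holderOnWith_add (hf : HolderOnWith C α f S) (hg : HolderOnWith D α g S) :
    HolderOnWith (C + D) α (f + g) S :=
  HolderWith.restrict_iff.1 ((HolderWith.restrict_iff.2 hf).add (HolderWith.restrict_iff.2 hg))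

theorem holderOnWith_const_mul (c : ℝ) (hf : HolderOnWith C α f S) :
    HolderOnWith (C * ‖c‖₊) α (fun x => c * f x) S :=
  HolderWith.restrict_iff.1 ((HolderWith.restrict_iff.2 hf).smul c)

theorem holderOnWith_of_le_Icc {f : ℝ → ℝ} {C α α' : ℝ≥0} {a b : ℝ}
    (hf : HolderOnWith C α' f (Icc a b)) (h : α ≤ α') :
    HolderOnWith (C * (b - a).toNNReal ^ (α' - α : ℝ)) α f (Icc a b) := by
  refine hf.of_le (fun x hx y hy => ?_) h
  rw [edist_dist]
  exact ENNReal.ofReal_le_ofReal (Real.dist_le_of_mem_Icc hx hy)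

theorem rpow_le_rpow_sub_mul_rpow {x η α α' : ℝ} (hx : 0 ≤ x) (hxη : x ≤ η) (hα : 0 ≤ α)
    (hαα' : α ≤ α') : x ^ α' ≤ η ^ (α' - α) * x ^ α := by
  rw [← sub_add_cancel α' α, Real.rpow_add_of_nonneg hx (sub_nonneg.2 hαα') hα,
    add_sub_cancel_right]
  gcongr

/-- Bound the smaller of the two displacements by its `α'`-Hölder estimate. -/
theorem abs_second_difference_le {w : ℝ → ℝ} {C α α' : ℝ≥0} {S : Set ℝ} {x y h η : ℝ}
    (hw : HolderOnWith C α' w S) (hαα' : α ≤ α') (hx : x ∈ S) (hxh : x + h ∈ S) (hy : y ∈ S)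
    (hyh : y + h ∈ S) (hxy : |x - y| ≤ η) :
    |(w (x + h) - w x) - (w (y + h) - w y)| ≤ 2 * C * η ^ (α' - α : ℝ) * |h| ^ (α : ℝ) := by
  have hη : 0 ≤ η := (abs_nonneg _).trans hxy
  have hdist : ∀ {u v}, u ∈ S → v ∈ S → |w u - w v| ≤ C * |u - v| ^ (α' : ℝ) :=
    fun hu hv => hw.dist_le hu hv
  rcases le_total |h| η with hh | hh
  · have hxx := hdist hxh hx
    have hyy := hdist hyh hy
    rw [add_sub_cancel_left] at hxx hyy
    calc _ ≤ |w (x + h) - w x| + |w (y + h) - w y| := abs_sub _ _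
      _ ≤ 2 * C * |h| ^ (α' : ℝ) := by linarith
      _ ≤ 2 * C * (η ^ (α' - α : ℝ) * |h| ^ (α : ℝ)) := by
        gcongr
        exact rpow_le_rpow_sub_mul_rpow (abs_nonneg h) hh α.coe_nonneg hαα'
      _ = _ := by ring
  · have hxyh := hdist hxh hyh
    rw [add_sub_add_right_eq_sub] at hxyh
    calc _ = |(w (x + h) - w (y + h)) - (w x - w y)| := by congr 1; ring
      _ ≤ |w (x + h) - w (y + h)| + |w x - w y| := abs_sub _ _
      _ ≤ 2 * C * |x - y| ^ (α' : ℝ) := by linarith [hdist hx hy]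
      _ ≤ 2 * C * η ^ (α' : ℝ) := by gcongr
      _ ≤ 2 * C * (η ^ (α' - α : ℝ) * η ^ (α : ℝ)) := by
        gcongr
        exact rpow_le_rpow_sub_mul_rpow hη le_rfl α.coe_nonneg hαα'
      _ ≤ 2 * C * (η ^ (α' - α : ℝ) * |h| ^ (α : ℝ)) := by gcongr
      _ = _ := by ring

/-- Two points on different sides of `c` are compared through `c`. -/
theorem holderOnWith_union {f : ℝ → ℝ} {C D α : ℝ≥0} {S T : Set ℝ} {c : ℝ}
    (hS : HolderOnWith C α f S) (hT : HolderOnWith D α f T) (hSc : S ⊆ Iic c) (hTc : T ⊆ Ici c)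
    (hcS : c ∈ S) (hcT : c ∈ T) : HolderOnWith (C + D) α f (S ∪ T) := by
  have across : ∀ x ∈ S, ∀ y ∈ T, edist (f x) (f y) ≤ ↑(C + D) * edist x y ^ (α : ℝ) := by
    intro x hx y hy
    have hxc : edist x c ≤ edist x y := by
      rw [edist_dist, edist_dist, Real.dist_eq, Real.dist_eq, abs_sub_comm x c, abs_sub_comm x y]
      have := mem_Iic.1 (hSc hx)
      have := mem_Ici.1 (hTc hy)
      exact ENNReal.ofReal_le_ofReal (abs_le_abs_of_nonneg (by linarith) (by linarith))
    have hcy : edist c y ≤ edist x y := by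
      rw [edist_dist, edist_dist, Real.dist_eq, Real.dist_eq, abs_sub_comm c y, abs_sub_comm x y]
      have := mem_Iic.1 (hSc hx)
      have := mem_Ici.1 (hTc hy)
      exact ENNReal.ofReal_le_ofReal (abs_le_abs_of_nonneg (by linarith) (by linarith))
    rw [ENNReal.coe_add, add_mul]
    exact (edist_triangle _ (f c) _).trans
      (add_le_add (hS.edist_le_of_le hx hcS hxc) (hT.edist_le_of_le hcT hy hcy))
  rintro x (hx | hx) y (hy | hy)
  · exact (hS.mono_const le_self_add) x hx y hy
  · exact across x hx y hy
  · rw [edist_comm (f x), edist_comm x]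
    exact across y hy x hx
  · exact (hT.mono_const le_add_self) x hx y hy

end Holder

section HolderNorm

variable {T : ℝ} {α : ℝ≥0}

theorem holderENorm_le {g : ℝ → ℝ} {K : ℝ≥0} (hT : 0 ≤ T) (hg₀ : g 0 = 0)
    (hg : HolderOnWith K α g (Icc 0 T)) :
    holderENorm T α g ≤ ↑(K * (T.toNNReal ^ (α : ℝ) + 1)) := by
  rw [mul_add, mul_one, ENNReal.coe_add]
  refine add_le_add (iSup_le fun t => ?_) (HolderWith.restrict_iff.2 hg).eHolderNorm_le
  have ht : edist (t : ℝ) 0 ≤ (T.toNNReal : ℝ≥0∞) := by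
    rw [edist_dist, Real.dist_0_eq_abs, abs_of_nonneg t.2.1]
    exact ENNReal.ofReal_le_ofReal t.2.2
  have h := hg.edist_le_of_le t.2 ⟨le_rfl, hT⟩ ht
  rw [hg₀, edist_zero_right] at h
  rwa [ENNReal.coe_mul, ENNReal.coe_rpow_of_nonneg _ α.coe_nonneg]

theorem tendstoHolder_of_holderOnWith_sub {u : ℝ → ℝ → ℝ} {v : ℝ → ℝ} {C : ℝ≥0} {κ : ℝ → ℝ≥0}
    (hT : 0 ≤ T) (hu₀ : ∀ ε, u ε 0 = 0) (hv₀ : v 0 = 0) (hv : HolderOnWith C α v (Icc 0 T))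
    (hκ : Tendsto κ (𝓝[>] 0) (𝓝 0))
    (huv : ∀ᶠ ε in 𝓝[>] (0 : ℝ), HolderOnWith (κ ε) α (fun t => u ε t - v t) (Icc 0 T)) :
    TendstoHolder T α u v := by
  refine ⟨(holderENorm_le hT hv₀ hv).trans_lt ENNReal.coe_lt_top, ?_, ?_⟩
  · filter_upwards [huv] with ε hε
    have hu : HolderOnWith (κ ε + C) α (u ε) (Icc 0 T) := by
      simpa only [Pi.add_def, sub_add_cancel] using holderOnWith_add hε hv
    exact (holderENorm_le hT (hu₀ ε) hu).trans_lt ENNReal.coe_lt_top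
  · have hbound : Tendsto (fun ε => ((κ ε * (T.toNNReal ^ (α : ℝ) + 1) : ℝ≥0) : ℝ≥0∞)) (𝓝[>] 0)
        (𝓝 0) := by
      simpa using ENNReal.tendsto_coe.2 (hκ.mul_const (T.toNNReal ^ (α : ℝ) + 1))
    refine tendsto_of_tendsto_of_tendsto_of_le_of_le' tendsto_const_nhds hbound
      (Eventually.of_forall fun _ => zero_le) ?_
    filter_upwards [huv] with ε hε
    exact holderENorm_le hT (by rw [hu₀, hv₀, sub_zero]) hε

end HolderNorm

/-! ### Mollification -/

open Metric Function
open scoped Convolution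

section Convolution

variable {k w : ℝ → ℝ} {η : ℝ}

theorem support_subset_ball_of_continuous (hk : Continuous k) (hη : η ≠ 0)
    (h : support k ⊆ closedBall 0 η) : support k ⊆ ball 0 η := by
  rw [← interior_closedBall 0 hη]
  exact interior_maximal h hk.isOpen_support

theorem hasCompactSupport_of_support_subset_ball (h : support k ⊆ ball 0 η) :
    HasCompactSupport k :=
  HasCompactSupport.of_support_subset_isCompact (isCompact_closedBall 0 η)
    (h.trans ball_subset_closedBall)

theorem abs_convolution_sub_le (hk : Integrable k) (hkη : support k ⊆ ball 0 η)
    (hw : Continuous w) {t z M : ℝ} (hM : 0 ≤ M) (hwM : ∀ x ∈ ball t η, |w x - z| ≤ M) :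
    |(k ⋆ w) t - (∫ x, k x) * z| ≤ (∫ x, |k x|) * M := by
  have h := dist_convolution_le' (ContinuousLinearMap.lsmul ℝ ℝ) hM hk hkη
    hw.aestronglyMeasurable hwM
  simpa only [ContinuousLinearMap.lsmul_apply, smul_eq_mul, integral_mul_const, Real.dist_eq,
    ContinuousLinearMap.opNorm_lsmul, one_mul, Real.norm_eq_abs] using h

theorem convolution_add_sub (hk : Continuous k) (hkc : HasCompactSupport k) (hw : Continuous w)
    (t h : ℝ) : (k ⋆ w) (t + h) - (k ⋆ w) t = (k ⋆ fun x => w (x + h) - w x) t := by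
  have hint : ∀ s, Integrable fun x => k x * w (s - x) := fun s =>
    (hk.mul (by fun_prop)).integrable_of_hasCompactSupport hkc.mul_right
  simp only [convolution, ContinuousLinearMap.lsmul_apply, smul_eq_mul, mul_sub,
    sub_add_eq_add_sub]
  exact (integral_sub (hint (t + h)) (hint t)).symm

/-- The increments of `k ⋆ w - w` are averages of second differences of `w`. -/
theorem holderOnWith_convolution_sub (hk : Continuous k) (hkη : support k ⊆ ball 0 η)
    (hk₁ : ∫ x, k x = 1) (hw : Continuous w) {C α α' : ℝ≥0} (hαα' : α ≤ α') {a b : ℝ}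
    (hη : 0 ≤ η) (hC : HolderOnWith C α' w (Icc (a - η) (b + η))) :
    HolderOnWith ((∫ x, |k x|) * (2 * C * η ^ (α' - α : ℝ))).toNNReal α
      (fun t => (k ⋆ w) t - w t) (Icc a b) := by
  have hkc := hasCompactSupport_of_support_subset_ball hkη
  have hmem : ∀ t ∈ Icc a b, ∀ x ∈ ball t η, x ∈ Icc (a - η) (b + η) := fun t ht x hx => by
    rw [Real.ball_eq_Ioo] at hx
    exact ⟨by linarith [ht.1, hx.1], by linarith [ht.2, hx.2]⟩
  have hsub : Icc a b ⊆ Icc (a - η) (b + η) := Icc_subset_Icc (by linarith) (by linarith)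
  refine holderOnWith_of_dist_le fun t ht s hs => ?_
  have hmod := abs_convolution_sub_le (t := s) (z := w t - w s)
    (M := 2 * C * η ^ (α' - α : ℝ) * |t - s| ^ (α : ℝ)) (w := fun x => w (x + (t - s)) - w x)
    (hk.integrable_of_hasCompactSupport hkc) hkη (by fun_prop) (by positivity) fun x hx => ?_
  · rw [hk₁, one_mul, ← convolution_add_sub hk hkc hw, add_sub_cancel] at hmod
    rw [Real.dist_eq, Real.dist_eq, sub_sub_sub_comm, mul_assoc]
    exact hmod
  · have hxt : x + (t - s) ∈ ball t η := by
      rwa [mem_ball, dist_eq_norm, add_sub_assoc, sub_sub_cancel_left, ← sub_eq_add_neg,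
        ← dist_eq_norm]
    simpa only [add_sub_cancel] using abs_second_difference_le hC hαα' (hmem s hs x hx)
      (hmem t ht _ hxt) (hsub hs) (by simpa only [add_sub_cancel] using hsub ht)
      (mem_ball.1 hx).le

end Convolution

section ScaledKernel

variable {ρ w : ℝ → ℝ} {γ ε : ℝ}

theorem mollified_eq_convolution (ρ : ℝ → ℝ) (γ : ℝ) (w : ℝ → ℝ) (ε : ℝ) :
    mollified ρ γ w ε = scaledKernel ρ γ ε ⋆ w :=
  funext fun _ => by simp only [mollified, convolution_lsmul_swap, smul_eq_mul]

theorem continuous_scaledKernel (hρ : Continuous ρ) : Continuous (scaledKernel ρ γ ε) := by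
  unfold scaledKernel
  fun_prop

theorem contDiff_scaledKernel {n : WithTop ℕ∞} (hρ : ContDiff ℝ n ρ) :
    ContDiff ℝ n (scaledKernel ρ γ ε) := by
  unfold scaledKernel
  fun_prop

theorem support_scaledKernel_subset (hε : 0 < ε) (hρ : support ρ ⊆ ball 0 1) :
    support (scaledKernel ρ γ ε) ⊆ ball 0 (ε ^ γ) := fun x hx => by
  have hη : 0 < ε ^ γ := Real.rpow_pos_of_pos hε γ
  have hmem := hρ (right_ne_zero_of_mul hx)
  rw [mem_ball_zero_iff, Real.norm_eq_abs, abs_div, abs_of_pos hη, div_lt_one hη] at hmem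
  rwa [mem_ball_zero_iff, Real.norm_eq_abs]

theorem integral_scaledKernel (hε : 0 < ε) (ρ : ℝ → ℝ) :
    ∫ x, scaledKernel ρ γ ε x = ∫ x, ρ x := by
  have hη : 0 < ε ^ γ := Real.rpow_pos_of_pos hε γ
  simp only [scaledKernel]
  rw [integral_const_mul, Measure.integral_comp_div ρ, abs_of_pos hη, smul_eq_mul,
    Real.rpow_neg hε.le, inv_mul_cancel_left₀ hη.ne']

theorem integral_abs_scaledKernel (hε : 0 < ε) (ρ : ℝ → ℝ) :
    ∫ x, |scaledKernel ρ γ ε x| = ∫ x, |ρ x| := by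
  rw [← integral_scaledKernel hε (γ := γ) fun x => |ρ x|]
  simp only [scaledKernel, abs_mul, abs_of_pos (Real.rpow_pos_of_pos hε (-γ))]

theorem deriv_scaledKernel (hε : 0 < ε) (ρ : ℝ → ℝ) :
    deriv (scaledKernel ρ γ ε) = ε ^ (-γ) • scaledKernel (deriv ρ) γ ε := by
  ext x
  rw [funext fun y => show scaledKernel ρ γ ε y = ε ^ (-γ) * ρ (ε ^ (-γ) * y) by
    rw [scaledKernel, Real.rpow_neg hε.le, div_eq_inv_mul]]
  simp only [scaledKernel, Pi.smul_apply, smul_eq_mul, div_eq_inv_mul, deriv_const_mul_field,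
    deriv_comp_mul_left, ← Real.rpow_neg hε.le]

end ScaledKernel

section Noise

variable {ρ w : ℝ → ℝ} {γ ε : ℝ}

theorem support_deriv_subset_ball (hρ : ContDiff ℝ 1 ρ) (hsupp : support ρ ⊆ ball 0 1) :
    support (deriv ρ) ⊆ ball 0 1 :=
  support_subset_ball_of_continuous (hρ.continuous_deriv le_rfl) one_ne_zero
    (support_deriv_subset.trans
      (closure_minimal (hsupp.trans ball_subset_closedBall) isClosed_closedBall))

theorem hasDerivAt_mollified_convolution (hρ : ContDiff ℝ 1 ρ) (hsupp : support ρ ⊆ ball 0 1)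
    (hw : Continuous w) (hε : 0 < ε) (t : ℝ) :
    HasDerivAt (mollified ρ γ w ε) (ε ^ (-γ) * (scaledKernel (deriv ρ) γ ε ⋆ w) t) t := by
  have hcompact := hasCompactSupport_of_support_subset_ball
    (support_scaledKernel_subset (γ := γ) hε hsupp)
  have h := hcompact.hasDerivAt_convolution_left (ContinuousLinearMap.lsmul ℝ ℝ)
    (contDiff_scaledKernel hρ) (hw.locallyIntegrable (μ := volume)) t
  rwa [deriv_scaledKernel hε, smul_convolution, ← mollified_eq_convolution] at h

theorem noise_eq_convolution (hρ : ContDiff ℝ 1 ρ) (hsupp : support ρ ⊆ ball 0 1)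
    (hw : Continuous w) (hε : 0 < ε) :
    noise ρ γ w ε = ε ^ (-γ) • (scaledKernel (deriv ρ) γ ε ⋆ w) :=
  funext fun t => (hasDerivAt_mollified_convolution hρ hsupp hw hε t).deriv

theorem hasDerivAt_mollified (hρ : ContDiff ℝ 1 ρ) (hsupp : support ρ ⊆ ball 0 1)
    (hw : Continuous w) (hε : 0 < ε) (t : ℝ) :
    HasDerivAt (mollified ρ γ w ε) (noise ρ γ w ε t) t :=
  (hasDerivAt_mollified_convolution hρ hsupp hw hε t).differentiableAt.hasDerivAt

theorem continuous_noise (hρ : ContDiff ℝ 1 ρ) (hsupp : support ρ ⊆ ball 0 1)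
    (hw : Continuous w) (hε : 0 < ε) : Continuous (noise ρ γ w ε) := by
  have hcompact := hasCompactSupport_of_support_subset_ball
    (support_scaledKernel_subset (γ := γ) hε (support_deriv_subset_ball hρ hsupp))
  rw [noise_eq_convolution hρ hsupp hw hε]
  exact (hcompact.continuous_convolution_left _
    (continuous_scaledKernel (hρ.continuous_deriv le_rfl)) hw.locallyIntegrable).const_smul _

theorem abs_noise_le (hρ : ContDiff ℝ 1 ρ) (hsupp : support ρ ⊆ ball 0 1) (hw : Continuous w)
    (hε : 0 < ε) {t M : ℝ} (hM : 0 ≤ M) (hwM : ∀ x ∈ ball t (ε ^ γ), |w x| ≤ M) :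
    |noise ρ γ w ε t| ≤ ε ^ (-γ) * ((∫ x, |deriv ρ x|) * M) := by
  have hsupp' := support_scaledKernel_subset (γ := γ) hε (support_deriv_subset_ball hρ hsupp)
  have hcont : Continuous (scaledKernel (deriv ρ) γ ε) :=
    continuous_scaledKernel (hρ.continuous_deriv le_rfl)
  have h := abs_convolution_sub_le (z := 0)
    (hcont.integrable_of_hasCompactSupport (hasCompactSupport_of_support_subset_ball hsupp'))
    hsupp' hw hM (by simpa only [sub_zero] using hwM)
  rw [mul_zero, sub_zero, integral_abs_scaledKernel hε] at h
  rw [noise_eq_convolution hρ hsupp hw hε, Pi.smul_apply, smul_eq_mul, abs_mul,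
    abs_of_pos (Real.rpow_pos_of_pos hε _)]
  gcongr

theorem holderOnWith_mollified_sub (hρ : Continuous ρ) (hsupp : support ρ ⊆ ball 0 1)
    (hρ₁ : ∫ x, ρ x = 1) (hw : Continuous w) (hε : 0 < ε) {C α α' : ℝ≥0} (hαα' : α ≤ α') {a b : ℝ}
    (hC : HolderOnWith C α' w (Icc (a - ε ^ γ) (b + ε ^ γ))) :
    HolderOnWith ((∫ x, |ρ x|) * (2 * C * (ε ^ γ) ^ (α' - α : ℝ))).toNNReal α
      (fun t => mollified ρ γ w ε t - w t) (Icc a b) := by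
  rw [mollified_eq_convolution, ← integral_abs_scaledKernel hε ρ (γ := γ)]
  exact holderOnWith_convolution_sub (continuous_scaledKernel hρ)
    (support_scaledKernel_subset hε hsupp) (by rw [integral_scaledKernel hε, hρ₁]) hw hαα'
    (Real.rpow_pos_of_pos hε γ).le hC

end Noise

/-! ### Convergence along a Hölder continuous path -/

section Convergence

variable {ρ w : ℝ → ℝ} {γ β σ T ε : ℝ}

theorem tendsto_rpow_nhdsGT_zero {p : ℝ} (hp : 0 < p) :
    Tendsto (fun ε : ℝ => ε ^ p) (𝓝[>] 0) (𝓝 0) := by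
  have h := (Real.continuousAt_rpow_const 0 p (Or.inr hp.le)).tendsto
  rw [Real.zero_rpow hp.ne'] at h
  exact h.mono_left nhdsWithin_le_nhds

theorem exists_abs_forcing_le (hρ : ContDiff ℝ 1 ρ) (hsupp : support ρ ⊆ ball 0 1)
    (hw : Continuous w) (hγ : 0 ≤ γ) (hβ : 1 - γ ≤ β) (σ T : ℝ) :
    ∃ A, ∀ ε ∈ Ioc (0 : ℝ) 1, ∀ s ∈ Icc 0 T, |forcing ρ γ β σ w ε s| ≤ A * ε ^ (1 - γ) := by
  obtain ⟨M, hM⟩ := (isCompact_Icc (a := (-1 : ℝ)) (b := T + 1)).exists_bound_of_continuousOn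
    hw.continuousOn
  refine ⟨(∫ x, |deriv ρ x|) * |M| + |σ|, fun ε ⟨hε, hε₁⟩ s hs => ?_⟩
  have hη : ε ^ γ ≤ 1 := Real.rpow_le_one hε.le hε₁ hγ
  have hnoise : |noise ρ γ w ε s| ≤ ε ^ (-γ) * ((∫ x, |deriv ρ x|) * |M|) :=
    abs_noise_le hρ hsupp hw hε (abs_nonneg M) fun x hx => by
      rw [Real.ball_eq_Ioo] at hx
      exact (hM x ⟨by linarith [hs.1, hx.1], by linarith [hs.2, hx.2]⟩).trans (le_abs_self M)
  have hpow : ε ^ β ≤ ε ^ (1 - γ) := Real.rpow_le_rpow_of_exponent_ge hε hε₁ hβ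
  calc |forcing ρ γ β σ w ε s|
      ≤ |ε * noise ρ γ w ε s| + |σ * ε ^ β| := abs_add_le _ _
    _ = ε * |noise ρ γ w ε s| + |σ| * ε ^ β := by
        rw [abs_mul, abs_mul, abs_of_pos hε, abs_of_pos (Real.rpow_pos_of_pos hε β)]
    _ ≤ ε * (ε ^ (-γ) * ((∫ x, |deriv ρ x|) * |M|)) + |σ| * ε ^ (1 - γ) := by gcongr
    _ = ((∫ x, |deriv ρ x|) * |M| + |σ|) * ε ^ (1 - γ) := by
        rw [sub_eq_add_neg, Real.rpow_add hε, Real.rpow_one]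
        ring

theorem eventually_abs_forcing_le (hρ : ContDiff ℝ 1 ρ) (hsupp : support ρ ⊆ ball 0 1)
    (hw : Continuous w) (hγ₀ : 0 ≤ γ) (hγ : γ < 1) (hβ : 1 - γ ≤ β) (σ T : ℝ) {r : ℝ}
    (hr : 0 < r) : ∀ᶠ ε in 𝓝[>] (0 : ℝ), ∀ s ∈ Icc 0 T, |forcing ρ γ β σ w ε s| ≤ r := by
  obtain ⟨A, hA⟩ := exists_abs_forcing_le hρ hsupp hw hγ₀ hβ σ T
  have htendsto := (tendsto_rpow_nhdsGT_zero (sub_pos.2 hγ)).const_mul A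
  rw [mul_zero] at htendsto
  filter_upwards [htendsto.eventually_le_const hr, Ioc_mem_nhdsGT zero_lt_one] with ε hAε hε s hs
  exact (hA ε hε s hs).trans hAε

theorem continuousOn_waveSpeed_forcing (hρ : ContDiff ℝ 1 ρ) (hsupp : support ρ ⊆ ball 0 1)
    (hw : Continuous w) (hε : 0 < ε) (hF : ∀ s ∈ Icc 0 T, |forcing ρ γ β σ w ε s| ≤ 3 / 8) :
    ContinuousOn (fun s => ε⁻¹ * waveSpeed (forcing ρ γ β σ w ε s)) (Icc 0 T) := by
  have hforcing : Continuous (forcing ρ γ β σ w ε) :=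
    ((continuous_noise hρ hsupp hw hε).const_mul ε).add_const (σ * ε ^ β)
  exact (lipschitzOnWith_waveSpeed.continuousOn.comp hforcing.continuousOn hF).const_mul ε⁻¹

theorem eventually_differentiableAt_mollified_and_hasWaveSpeed (hρ : ContDiff ℝ 1 ρ)
    (hsupp : support ρ ⊆ ball 0 1) (hw : Continuous w) (hγ₀ : 0 ≤ γ) (hγ : γ < 1)
    (hβ : 1 - γ ≤ β) (hT : 0 ≤ T) :
    ∀ᶠ ε in 𝓝[>] (0 : ℝ),
      (∀ s ∈ Icc 0 T, DifferentiableAt ℝ (mollified ρ γ w ε) s ∧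
        HasWaveSpeed (forcing ρ γ β σ w ε s)) ∧
      IntervalIntegrable (fun s => ε⁻¹ * waveSpeed (forcing ρ γ β σ w ε s)) volume 0 T := by
  filter_upwards [eventually_abs_forcing_le hρ hsupp hw hγ₀ hγ hβ σ T
    (show (0 : ℝ) < 3 / 8 by norm_num), self_mem_nhdsWithin] with ε hF hε
  refine ⟨fun s hs => ⟨(hasDerivAt_mollified hρ hsupp hw hε s).differentiableAt,
    hasWaveSpeed_of_abs_le (hF s hs)⟩, ContinuousOn.intervalIntegrable ?_⟩
  rw [uIcc_of_le hT]
  exact continuousOn_waveSpeed_forcing hρ hsupp hw hε hF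

theorem abs_inv_mul_waveSpeed_add_le {A s : ℝ} (hε : 0 < ε)
    (hF : |forcing ρ γ β σ w ε s| ≤ 3 / 8)
    (hA : |forcing ρ γ β σ w ε s| ≤ A * ε ^ (1 - γ)) :
    |ε⁻¹ * waveSpeed (forcing ρ γ β σ w ε s) + c₀ * noise ρ γ w ε s| ≤
      3 * c₀ * A ^ 3 * ε ^ (2 - 3 * γ) + c₀ * |σ| * ε ^ (β - 1) := by
  have hc := c₀_pos
  set F := forcing ρ γ β σ w ε s with hF_def
  have hsplit : ε⁻¹ * waveSpeed F + c₀ * noise ρ γ w ε s =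
      ε⁻¹ * (waveSpeed F + c₀ * F) - c₀ * σ * ε ^ (β - 1) := by
    rw [mul_add, hF_def, forcing, Real.rpow_sub hε, Real.rpow_one]
    field_simp
    ring
  have hcube : (A * ε ^ (1 - γ)) ^ 3 = A ^ 3 * (ε * ε ^ (2 - 3 * γ)) := by
    rw [mul_pow, ← Real.rpow_mul_natCast hε.le, mul_comm ε, ← Real.rpow_add_one hε.ne']
    push_cast
    ring_nf
  have hmain : |waveSpeed F + c₀ * F| ≤ 3 * c₀ * (A ^ 3 * (ε * ε ^ (2 - 3 * γ))) := by
    rw [← hcube]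
    exact (abs_waveSpeed_add_le hF).trans (by gcongr)
  rw [hsplit]
  refine (abs_sub _ _).trans (add_le_add ?_ ?_)
  · rw [abs_mul, abs_of_pos (inv_pos.2 hε), inv_mul_le_iff₀ hε]
    linarith
  · rw [abs_mul, abs_mul, abs_of_pos hc, abs_of_pos (Real.rpow_pos_of_pos hε _)]

theorem mul_Wpm_sub {s t : ℝ}
    (hint : ContinuousOn (fun r => ε⁻¹ * waveSpeed (forcing ρ γ β σ w ε r)) (Icc 0 T))
    (hs : s ∈ Icc 0 T) (ht : t ∈ Icc 0 T) :
    c₀ * Wpm ρ γ β σ w ε t - c₀ * Wpm ρ γ β σ w ε s =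
      ∫ r in s..t, ε⁻¹ * waveSpeed (forcing ρ γ β σ w ε r) := by
  have hint' : ∀ x ∈ Icc 0 T, IntervalIntegrable
      (fun r => ε⁻¹ * waveSpeed (forcing ρ γ β σ w ε r)) volume 0 x := fun x hx =>
    (hint.mono (ordConnected_Icc.uIcc_subset ⟨le_rfl, hx.1.trans hx.2⟩ hx)).intervalIntegrable
  rw [← intervalIntegral.integral_interval_sub_left (hint' t ht) (hint' s hs), Wpm, Wpm,
    ← mul_assoc, ← mul_assoc, mul_one_div_cancel c₀_pos.ne', one_mul, one_mul]

theorem holderOnWith_mul_Wpm_add_mul_mollified (hρ : ContDiff ℝ 1 ρ)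
    (hsupp : support ρ ⊆ ball 0 1) (hw : Continuous w) (hε : 0 < ε) {L : ℝ}
    (hF : ∀ s ∈ Icc 0 T, |forcing ρ γ β σ w ε s| ≤ 3 / 8)
    (hL : ∀ s ∈ Icc 0 T,
      |ε⁻¹ * waveSpeed (forcing ρ γ β σ w ε s) + c₀ * noise ρ γ w ε s| ≤ L) :
    HolderOnWith L.toNNReal 1
      (fun t => c₀ * Wpm ρ γ β σ w ε t + c₀ * mollified ρ γ w ε t) (Icc 0 T) := by
  have hcont := continuousOn_waveSpeed_forcing hρ hsupp hw hε hF
  have hnoise := continuous_noise (γ := γ) hρ hsupp hw hε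
  refine holderOnWith_of_dist_le fun t ht s hs => ?_
  have hst : uIcc s t ⊆ Icc 0 T := ordConnected_Icc.uIcc_subset hs ht
  have hmollified : ∫ r in s..t, c₀ * noise ρ γ w ε r =
      c₀ * mollified ρ γ w ε t - c₀ * mollified ρ γ w ε s := by
    rw [intervalIntegral.integral_const_mul, ← mul_sub,
      intervalIntegral.integral_eq_sub_of_hasDerivAt
        (fun r _ => hasDerivAt_mollified hρ hsupp hw hε r) (hnoise.intervalIntegrable _ _)]
  rw [Real.dist_eq, Real.dist_eq, add_sub_add_comm, mul_Wpm_sub hcont hs ht, ← hmollified,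
    ← intervalIntegral.integral_add (hcont.mono hst).intervalIntegrable
      ((hnoise.const_mul c₀).intervalIntegrable _ _), NNReal.coe_one, Real.rpow_one,
    ← Real.norm_eq_abs]
  exact intervalIntegral.norm_integral_le_of_norm_le_const fun r hr =>
    hL r (hst (uIoc_subset_uIcc hr))

theorem holderOnWith_mul_Wpm_sub_neg_mul (hρ : ContDiff ℝ 1 ρ) (hsupp : support ρ ⊆ ball 0 1)
    (hρ₁ : ∫ x, ρ x = 1) (hw : Continuous w) (hε : 0 < ε) {C α α' : ℝ≥0} (hαα' : α ≤ α')
    (hα₁ : α ≤ 1) {L : ℝ} (hF : ∀ s ∈ Icc 0 T, |forcing ρ γ β σ w ε s| ≤ 3 / 8)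
    (hL : ∀ s ∈ Icc 0 T,
      |ε⁻¹ * waveSpeed (forcing ρ γ β σ w ε s) + c₀ * noise ρ γ w ε s| ≤ L)
    (hC : HolderOnWith C α' w (Icc (0 - ε ^ γ) (T + ε ^ γ))) :
    HolderOnWith (L.toNNReal * T.toNNReal ^ (1 - α : ℝ) +
        ((∫ x, |ρ x|) * (2 * C * (ε ^ γ) ^ (α' - α : ℝ))).toNNReal * ‖-c₀‖₊) α
      (fun t => c₀ * Wpm ρ γ β σ w ε t - -(c₀ * w t)) (Icc 0 T) := by
  have hspeed := holderOnWith_of_le_Icc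
    (holderOnWith_mul_Wpm_add_mul_mollified hρ hsupp hw hε hF hL) hα₁
  have hmollified := holderOnWith_const_mul (-c₀)
    (holderOnWith_mollified_sub hρ.continuous hsupp hρ₁ hw hε hαα' hC)
  have hsum : (fun t => c₀ * Wpm ρ γ β σ w ε t - -(c₀ * w t)) =
      (fun t => c₀ * Wpm ρ γ β σ w ε t + c₀ * mollified ρ γ w ε t) +
        fun t => -c₀ * (mollified ρ γ w ε t - w t) := by
    ext t
    simp only [Pi.add_apply]
    ring
  rw [sub_zero, NNReal.coe_one] at hspeed
  rw [hsum]
  exact holderOnWith_add hspeed hmollified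

theorem tendstoHolder_mul_Wpm (hρ : ContDiff ℝ 1 ρ) (hsupp : support ρ ⊆ ball 0 1)
    (hρ₁ : ∫ x, ρ x = 1) (hw : Continuous w) (hw₀ : w 0 = 0) (hγ₀ : 0 < γ) (hγ : γ < 2 / 3)
    (hβ : 1 < β) (σ : ℝ) (hT : 0 ≤ T) {C α α' : ℝ≥0} (hαα' : α < α') (hα₁ : α ≤ 1)
    (hC : HolderOnWith C α' w (Icc (-1) (T + 1))) :
    TendstoHolder T α (fun ε t => c₀ * Wpm ρ γ β σ w ε t) (fun t => -(c₀ * w t)) := by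
  obtain ⟨A, hA⟩ := exists_abs_forcing_le hρ hsupp hw hγ₀.le (show 1 - γ ≤ β by linarith) σ T
  have hgap : (0 : ℝ) < α' - α := sub_pos.2 hαα'
  have hspeed : Tendsto (fun ε => 3 * c₀ * A ^ 3 * ε ^ (2 - 3 * γ) + c₀ * |σ| * ε ^ (β - 1))
      (𝓝[>] 0) (𝓝 0) := by
    simpa only [mul_zero, add_zero] using
      ((tendsto_rpow_nhdsGT_zero (show 0 < 2 - 3 * γ by linarith)).const_mul _).add
        ((tendsto_rpow_nhdsGT_zero (sub_pos.2 hβ)).const_mul _)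
  have hmollified : Tendsto (fun ε : ℝ => (∫ x, |ρ x|) * (2 * C * (ε ^ γ) ^ (α' - α : ℝ)))
      (𝓝[>] 0) (𝓝 0) := by
    simpa only [Real.zero_rpow hgap.ne', mul_zero] using
      (((tendsto_rpow_nhdsGT_zero hγ₀).rpow_const (Or.inr hgap.le)).const_mul _).const_mul _
  have hv : HolderOnWith _ α (fun t => -c₀ * w t) (Icc 0 T) := holderOnWith_const_mul (-c₀)
    (holderOnWith_of_le_Icc (hC.mono (Icc_subset_Icc (by norm_num) (by linarith))) hαα'.le)
  simp only [neg_mul] at hv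
  have hκ := ((tendsto_real_toNNReal hspeed).mul_const (T.toNNReal ^ (1 - α : ℝ))).add
    ((tendsto_real_toNNReal hmollified).mul_const ‖-c₀‖₊)
  rw [Real.toNNReal_zero, zero_mul, zero_mul, add_zero] at hκ
  refine tendstoHolder_of_holderOnWith_sub hT (fun ε => by simp [Wpm]) (by simp [hw₀]) hv hκ ?_
  filter_upwards [eventually_abs_forcing_le hρ hsupp hw hγ₀.le (by linarith)
    (show 1 - γ ≤ β by linarith) σ T (show (0 : ℝ) < 3 / 8 by norm_num),
    Ioc_mem_nhdsGT zero_lt_one] with ε hF hε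
  have hη : ε ^ γ ≤ 1 := Real.rpow_le_one hε.1.le hε.2 hγ₀.le
  exact holderOnWith_mul_Wpm_sub_neg_mul hρ hsupp hρ₁ hw hε.1 hαα'.le hα₁ hF
    (fun s hs => abs_inv_mul_waveSpeed_add_le hε.1 (hF s hs) (hA ε hε s hs))
    (hC.mono (Icc_subset_Icc (by linarith) (by linarith)))

end Convergence

/-! ### Hölder continuity of Brownian paths -/

section Chaining

variable {E : Type*} [PseudoMetricSpace E] {g : ℝ → E} {D q t : ℝ} {n : ℕ}

/-- The largest dyadic point `k / 2 ^ n` that is at most `t`, for `0 ≤ t`. -/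
noncomputable def dyadicFloor (n : ℕ) (t : ℝ) : ℝ := ⌊t * 2 ^ n⌋₊ / 2 ^ n

/-- The increments of `g` between neighbouring dyadic points of level `n` in `[0, 1]` are at most
`D`: the information on a path that chaining turns into Hölder continuity. -/
def DyadicIncrementsLE (g : ℝ → E) (n : ℕ) (D : ℝ) : Prop :=
  ∀ k : ℕ, k < 2 ^ n → dist (g (k / 2 ^ n)) (g ((k + 1 : ℕ) / 2 ^ n)) ≤ D

theorem DyadicIncrementsLE.dist_le (h : DyadicIncrementsLE g n D) (hD : 0 ≤ D) {j k : ℕ}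
    (hjk : j ≤ k) (hkj : k ≤ j + 1) (hk : k ≤ 2 ^ n) :
    dist (g (j / 2 ^ n)) (g (k / 2 ^ n)) ≤ D := by
  obtain rfl | rfl : k = j ∨ k = j + 1 := by omega
  · rwa [dist_self]
  · exact h j (by omega)

theorem floor_mul_two_pow_le (ht : t ≤ 1) : ⌊t * 2 ^ n⌋₊ ≤ 2 ^ n :=
  Nat.floor_le_of_le (by
    push_cast
    exact mul_le_of_le_one_left (by positivity) ht)

theorem tendsto_dyadicFloor (ht : 0 ≤ t) : Tendsto (fun n => dyadicFloor n t) atTop (𝓝 t) :=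
  (tendsto_nat_floor_mul_div_atTop ht).comp (tendsto_pow_atTop_atTop_of_one_lt one_lt_two)

theorem dist_dyadicFloor_succ_le (h : DyadicIncrementsLE g (n + 1) D) (hD : 0 ≤ D)
    (ht : t ∈ Icc 0 1) : dist (g (dyadicFloor n t)) (g (dyadicFloor (n + 1) t)) ≤ D := by
  have hx : 0 ≤ t * 2 ^ n := mul_nonneg ht.1 (by positivity)
  have hdouble : t * 2 ^ (n + 1) = 2 * (t * 2 ^ n) := by ring
  have hfloor : dyadicFloor n t = ((2 * ⌊t * 2 ^ n⌋₊ : ℕ) : ℝ) / 2 ^ (n + 1) := by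
    rw [dyadicFloor]
    push_cast
    field_simp
    ring
  rw [hfloor, dyadicFloor]
  refine h.dist_le hD ?_ ?_ (floor_mul_two_pow_le ht.2)
  · rw [hdouble]
    refine Nat.le_floor ?_
    push_cast
    linarith [Nat.floor_le hx]
  · rw [hdouble, ← Nat.lt_add_one_iff, Nat.floor_lt (by positivity)]
    push_cast
    linarith [Nat.lt_floor_add_one (t * 2 ^ n)]

theorem dist_dyadicFloor_le (hg : Continuous g) (hD : 0 ≤ D) (hq₀ : 0 ≤ q) (hq₁ : q < 1)
    (h : ∀ n, DyadicIncrementsLE g n (D * q ^ n)) (ht : t ∈ Icc 0 1) (n : ℕ) :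
    dist (g (dyadicFloor n t)) (g t) ≤ D * q * q ^ n / (1 - q) := by
  refine dist_le_of_le_geometric_of_tendsto q (D * q) hq₁ (fun m => ?_)
    ((hg.tendsto t).comp (tendsto_dyadicFloor ht.1)) n
  rw [mul_assoc, ← pow_succ']
  exact dist_dyadicFloor_succ_le (h (m + 1)) (by positivity) ht

theorem dist_le_of_dyadicIncrementsLE (hg : Continuous g) (hD : 0 ≤ D) (hq₀ : 0 ≤ q) (hq₁ : q < 1)
    (h : ∀ n, DyadicIncrementsLE g n (D * q ^ n)) {s : ℝ} (hs : s ∈ Icc 0 1) (ht : t ∈ Icc 0 1)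
    (hst : s ≤ t) (hts : t - s ≤ (1 / 2) ^ n) :
    dist (g s) (g t) ≤ D * (1 + 2 * q / (1 - q)) * q ^ n := by
  have hle : t * 2 ^ n ≤ s * 2 ^ n + 1 := by
    rw [one_div_pow, le_div_iff₀ (by positivity)] at hts
    linarith
  have hmiddle : dist (g (dyadicFloor n s)) (g (dyadicFloor n t)) ≤ D * q ^ n := by
    refine (h n).dist_le (by positivity) (Nat.floor_mono (by gcongr)) ?_ (floor_mul_two_pow_le ht.2)
    rw [← Nat.floor_add_one (mul_nonneg hs.1 (by positivity))]
    exact Nat.floor_mono hle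
  have hleft := dist_dyadicFloor_le hg hD hq₀ hq₁ h hs n
  have hright := dist_dyadicFloor_le hg hD hq₀ hq₁ h ht n
  rw [dist_comm] at hleft
  calc dist (g s) (g t)
      ≤ _ := dist_triangle4 _ (g (dyadicFloor n s)) (g (dyadicFloor n t)) _
    _ ≤ D * q * q ^ n / (1 - q) + D * q ^ n + D * q * q ^ n / (1 - q) := by gcongr
    _ = _ := by ring

theorem exists_holderOnWith_of_dyadicIncrementsLE {α : ℝ≥0} (hg : Continuous g) (hα : 0 < α)
    (hD : 0 ≤ D) (h : ∀ n, DyadicIncrementsLE g n (D * ((1 / 2 : ℝ) ^ (α : ℝ)) ^ n)) :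
    ∃ C, HolderOnWith C α g (Icc 0 1) := by
  set q : ℝ := (1 / 2) ^ (α : ℝ) with hq
  have hq₁ : q < 1 := Real.rpow_lt_one (by norm_num) (by norm_num) hα
  set K := D * (1 + 2 * q / (1 - q))
  have : 0 ≤ K := by
    have := sub_pos.2 hq₁
    positivity
  have dist_le : ∀ s ∈ Icc (0 : ℝ) 1, ∀ t ∈ Icc (0 : ℝ) 1, s < t →
      dist (g s) (g t) ≤ K * 2 ^ (α : ℝ) * dist s t ^ (α : ℝ) := by
    intro s hs t ht hst
    have hpos := sub_pos.2 hst
    obtain ⟨n, hn, hn'⟩ := exists_nat_pow_near_of_lt_one hpos (by linarith [hs.1, ht.2])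
      (one_half_pos (α := ℝ)) one_half_lt_one
    rw [dist_comm s, Real.dist_eq, abs_of_pos hpos]
    calc dist (g s) (g t) ≤ K * q ^ n :=
          dist_le_of_dyadicIncrementsLE hg hD (by positivity) hq₁ h hs ht hst.le hn'
      _ = K * ((1 / 2) ^ n) ^ (α : ℝ) := by rw [hq, Real.rpow_pow_comm (by norm_num)]
      _ ≤ K * (2 * (t - s)) ^ (α : ℝ) := by
        gcongr
        rw [pow_succ] at hn
        linarith
      _ = _ := by rw [Real.mul_rpow zero_le_two hpos.le, ← mul_assoc]
  refine ⟨(K * 2 ^ (α : ℝ)).toNNReal, holderOnWith_of_dist_le fun s hs t ht => ?_⟩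
  rcases lt_trichotomy s t with hst | rfl | hts
  · exact dist_le s hs t ht hst
  · rw [dist_self]
    positivity
  · rw [dist_comm, dist_comm s]
    exact dist_le t ht s hs hts

theorem exists_forall_dyadicIncrementsLE_of_eventually (hg : Continuous g) (hq₀ : 0 < q)
    (hq₁ : q ≤ 1) (h : ∀ᶠ n in atTop, DyadicIncrementsLE g n (q ^ n)) :
    ∃ D, 0 ≤ D ∧ ∀ n, DyadicIncrementsLE g n (D * q ^ n) := by
  obtain ⟨N, hN⟩ := eventually_atTop.1 h
  obtain ⟨M, hM⟩ := Metric.isBounded_iff.1 ((isCompact_Icc (a := 0) (b := 1)).image hg).isBounded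
  have hdyadic : ∀ {n k : ℕ}, k ≤ 2 ^ n → g (k / 2 ^ n) ∈ g '' Icc 0 1 := fun {n k} hk =>
    mem_image_of_mem g ⟨by positivity, (div_le_one (by positivity)).2 (by exact_mod_cast hk)⟩
  have hM₀ : 0 ≤ M := dist_nonneg.trans (hM (hdyadic (zero_le (a := 2 ^ 0)))
    (hdyadic (zero_le (a := 2 ^ 0))))
  refine ⟨1 + M / q ^ N, by positivity, fun n k hk => ?_⟩
  rw [add_mul, one_mul]
  rcases le_total N n with hn | hn
  · exact (hN n hn k hk).trans (le_add_of_nonneg_right (by positivity))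
  · refine (hM (hdyadic hk.le) (hdyadic hk)).trans (le_add_of_nonneg_of_le (by positivity) ?_)
    rw [div_mul_eq_mul_div, le_div_iff₀ (by positivity)]
    exact mul_le_mul_of_nonneg_left (pow_le_pow_of_le_one hq₀.le hq₁ hn) hM₀

end Chaining

section KolmogorovChentsov

theorem pow_rpow_comm (a : ℝ≥0) (n : ℕ) (x : ℝ) : (a ^ n) ^ x = (a ^ x) ^ n := by
  rw [← NNReal.rpow_natCast, ← NNReal.rpow_natCast, ← NNReal.rpow_mul, ← NNReal.rpow_mul, mul_comm]

variable {Ω E : Type*} [MeasurableSpace Ω] {P : Measure Ω} {p q : ℝ} {M : ℝ≥0}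

section EMetric

variable {T : Type*} [PseudoEMetricSpace T] [PseudoEMetricSpace E] {X : T → Ω → E}

theorem isAEKolmogorovProcess_comp {S : Type*} [PseudoEMetricSpace S]
    (hX : IsAEKolmogorovProcess X P p q M) {φ : S → T} {K : ℝ≥0} (hφ : LipschitzWith K φ) :
    IsAEKolmogorovProcess (fun s => X (φ s)) P p q (M * K ^ q) := by
  obtain ⟨Y, hY, hXY⟩ := hX
  refine ⟨fun s => Y (φ s), ⟨fun s t => hY.measurablePair _ _, fun s t => ?_, hY.p_pos, hY.q_pos⟩,
    fun s => hXY (φ s)⟩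
  calc ∫⁻ ω, edist (Y (φ s) ω) (Y (φ t) ω) ^ p ∂P
      ≤ M * edist (φ s) (φ t) ^ q := hY.kolmogorovCondition _ _
    _ ≤ M * (K * edist s t) ^ q := by
      gcongr
      · exact hY.q_pos.le
      · exact hφ s t
    _ = _ := by
      rw [ENNReal.mul_rpow_of_nonneg _ _ hY.q_pos.le, ← ENNReal.coe_rpow_of_nonneg _ hY.q_pos.le,
        ENNReal.coe_mul, mul_assoc]

theorem measure_le_edist_le (hX : IsAEKolmogorovProcess X P p q M) {l : ℝ≥0} (hl : l ≠ 0)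
    (s t : T) : P {ω | l ≤ edist (X s ω) (X t ω)} ≤ M * edist s t ^ q / l ^ p := by
  have hp := hX.p_pos
  calc P {ω | l ≤ edist (X s ω) (X t ω)}
      = P {ω | (l : ℝ≥0∞) ^ p ≤ edist (X s ω) (X t ω) ^ p} := by
        simp only [ENNReal.rpow_le_rpow_iff hp]
    _ ≤ (∫⁻ ω, edist (X s ω) (X t ω) ^ p ∂P) / l ^ p :=
        meas_ge_le_lintegral_div (hX.aemeasurable_edist.pow_const p)
          (by simp [hl]) (by simp [hp.le])
    _ ≤ _ := by
      gcongr
      exact hX.kolmogorovCondition s t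

end EMetric

variable [PseudoMetricSpace E]

theorem measure_not_dyadicIncrementsLE_le {X : ℝ → Ω → E} (hX : IsAEKolmogorovProcess X P p q M)
    {a : ℝ≥0} (ha : a ≠ 0) (n : ℕ) :
    P {ω | ¬DyadicIncrementsLE (fun t => X t ω) n (a ^ n : ℝ≥0)} ≤
      ↑(M * (2 * (1 / 2) ^ q / a ^ p) ^ n) := by
  have hone : ∀ k ∈ Finset.range (2 ^ n),
      P {ω | ↑(a ^ n) ≤ edist (X (k / 2 ^ n) ω) (X ((k + 1 : ℕ) / 2 ^ n) ω)} ≤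
        ↑(M * ((1 / 2) ^ q / a ^ p) ^ n) := fun k _ => by
    have hdist : edist ((k : ℝ) / 2 ^ n) ((k + 1 : ℕ) / 2 ^ n) = ((1 / 2) ^ n : ℝ≥0) := by
      rw [edist_nndist]
      congr 1
      ext
      rw [coe_nndist, dist_comm, Real.dist_eq, ← sub_div]
      push_cast
      rw [add_sub_cancel_left, abs_of_pos (by positivity), one_div_pow]
    refine (measure_le_edist_le hX (pow_ne_zero n ha) _ _).trans_eq ?_
    rw [hdist, ← ENNReal.coe_rpow_of_nonneg _ hX.q_pos.le,
      ← ENNReal.coe_rpow_of_nonneg _ hX.p_pos.le, ← ENNReal.coe_mul,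
      ← ENNReal.coe_div (by simp [ha]), pow_rpow_comm, pow_rpow_comm, mul_div_assoc, div_pow]
  calc P {ω | ¬DyadicIncrementsLE (fun t => X t ω) n (a ^ n : ℝ≥0)}
      ≤ P (⋃ k ∈ Finset.range (2 ^ n),
          {ω | ↑(a ^ n) ≤ edist (X (k / 2 ^ n) ω) (X ((k + 1 : ℕ) / 2 ^ n) ω)}) := by
        refine measure_mono fun ω hω => ?_
        obtain ⟨k, hk, hlt⟩ : ∃ k : ℕ, k < 2 ^ n ∧
            ((a ^ n : ℝ≥0) : ℝ) < dist (X (k / 2 ^ n) ω) (X ((k + 1 : ℕ) / 2 ^ n) ω) := by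
          simpa only [DyadicIncrementsLE, mem_ofPred_eq, not_forall, not_le, exists_prop] using hω
        refine mem_biUnion (Finset.mem_range.2 hk) ?_
        rw [mem_ofPred_eq, edist_nndist]
        exact_mod_cast hlt.le
    _ ≤ ∑ _k ∈ Finset.range (2 ^ n), ↑(M * ((1 / 2) ^ q / a ^ p) ^ n) :=
        (measure_biUnion_finset_le _ _).trans (Finset.sum_le_sum hone)
    _ = _ := by
      rw [Finset.sum_const, Finset.card_range, nsmul_eq_mul, ← ENNReal.coe_natCast,
        ← ENNReal.coe_mul, mul_div_assoc, mul_pow 2]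
      push_cast
      ring_nf

theorem ae_eventually_dyadicIncrementsLE {X : ℝ → Ω → E} (hX : IsAEKolmogorovProcess X P p q M)
    {a : ℝ≥0} (ha : 2 * (1 / 2) ^ q < a ^ p) :
    ∀ᵐ ω ∂P, ∀ᶠ n in atTop, DyadicIncrementsLE (fun t => X t ω) n (a ^ n : ℝ≥0) := by
  have ha₀ : a ≠ 0 := by
    rintro rfl
    simp [hX.p_pos.ne'] at ha
  have hratio : 2 * (1 / 2) ^ q / a ^ p < 1 := (div_lt_one (zero_le.trans_lt ha)).2 ha
  have hsum : ∑' n, P {ω | ¬DyadicIncrementsLE (fun t => X t ω) n (a ^ n : ℝ≥0)} ≠ ∞ :=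
    ne_top_of_le_ne_top
      (ENNReal.tsum_coe_ne_top_iff_summable.2 ((NNReal.summable_geometric hratio).mul_left M))
      (ENNReal.tsum_le_tsum (measure_not_dyadicIncrementsLE_le hX ha₀))
  filter_upwards [ae_eventually_notMem hsum] with ω hω
  exact hω.mono fun n hn => not_not.1 hn

theorem ae_exists_holderOnWith_Icc {X : ℝ → Ω → E} (hX : IsAEKolmogorovProcess X P p q M)
    (hcont : ∀ᵐ ω ∂P, Continuous fun t => X t ω) {α : ℝ≥0} (hα : 0 < α) (hαp : α * p < q - 1) :
    ∀ᵐ ω ∂P, ∃ C, HolderOnWith C α (fun t => X t ω) (Icc 0 1) := by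
  have ha : 2 * (1 / 2) ^ q < ((1 / 2 : ℝ≥0) ^ (α : ℝ)) ^ p := by
    calc 2 * (1 / 2 : ℝ≥0) ^ q = (1 / 2) ^ (q - 1) := by
          rw [NNReal.rpow_sub_one (by norm_num)]
          field_simp
      _ < (1 / 2) ^ (α * p) :=
          NNReal.rpow_lt_rpow_of_exponent_gt (by norm_num) (NNReal.half_lt_self one_ne_zero) hαp
      _ = _ := NNReal.rpow_mul _ _ _
  filter_upwards [hcont, ae_eventually_dyadicIncrementsLE hX ha] with ω hω hincr
  obtain ⟨D, hD, hall⟩ := exists_forall_dyadicIncrementsLE_of_eventually hω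
    (Real.rpow_pos_of_pos one_half_pos α)
    (Real.rpow_le_one one_half_pos.le one_half_lt_one.le α.coe_nonneg) (by simpa using hincr)
  exact exists_holderOnWith_of_dyadicIncrementsLE hω hα hD hall

theorem ae_exists_holderOnWith_Iic {X : ℝ≥0 → Ω → E} (hX : IsAEKolmogorovProcess X P p q M)
    (hcont : ∀ᵐ ω ∂P, Continuous fun t => X t ω) {α : ℝ≥0} (hα : 0 < α) (hαp : α * p < q - 1)
    {R : ℝ≥0} (hR : R ≠ 0) : ∀ᵐ ω ∂P, ∃ C, HolderOnWith C α (fun t => X t ω) (Iic R) := by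
  have : (R : ℝ) ≠ 0 := NNReal.coe_ne_zero.2 hR
  have hmul : LipschitzWith R fun t : ℝ => R * t.toNNReal := by
    have h : LipschitzWith R fun t : ℝ≥0 => R * t := LipschitzWith.of_dist_le_mul fun s t => by
      rw [NNReal.dist_eq, NNReal.coe_mul, NNReal.coe_mul, ← mul_sub, abs_mul, NNReal.abs_eq,
        NNReal.dist_eq]
    simpa only [Function.comp_def, mul_one] using h.comp Real.lipschitzWith_toNNReal
  have hdiv : LipschitzWith R⁻¹ fun t : ℝ≥0 => (t : ℝ) / R := LipschitzWith.of_dist_le_mul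
    fun s t => by
      rw [Real.dist_eq, ← sub_div, abs_div, NNReal.abs_eq, NNReal.dist_eq, NNReal.coe_inv,
        div_eq_inv_mul]
  filter_upwards [ae_exists_holderOnWith_Icc (isAEKolmogorovProcess_comp hX hmul)
    (hcont.mono fun ω hω => hω.comp hmul.continuous) hα hαp] with ω ⟨C, hC⟩
  have hmaps : MapsTo (fun t : ℝ≥0 => (t : ℝ) / R) (Iic R) (Icc 0 1) := fun t ht =>
    ⟨by positivity, div_le_one_of_le₀ (NNReal.coe_le_coe.2 ht) R.coe_nonneg⟩
  have hcancel : ∀ t : ℝ≥0, R * ((t : ℝ) / R).toNNReal = t := fun t => by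
    rw [← NNReal.coe_div, Real.toNNReal_coe, mul_div_cancel₀ t hR]
  refine ⟨C * R⁻¹ ^ (α : ℝ), ?_⟩
  simpa only [Function.comp_def, hcancel, mul_one] using
    hC.comp (holderOnWith_one.2 hdiv.lipschitzOnWith) hmaps

end KolmogorovChentsov

section Brownian

theorem lintegral_enorm_rpow_gaussianReal {p : ℝ} (hp : 0 ≤ p) (v : ℝ≥0) :
    ∫⁻ x, ‖x‖ₑ ^ p ∂gaussianReal 0 v =
      (v : ℝ≥0∞) ^ (p / 2) * ∫⁻ x, ‖x‖ₑ ^ p ∂gaussianReal 0 1 := by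
  have hscale : gaussianReal 0 v = (gaussianReal 0 1).map (√v * ·) := by
    rw [gaussianReal_map_const_mul, mul_zero]
    congr 1
    ext
    simp
  have hsqrt : ‖√(v : ℝ)‖ₑ ^ p = (v : ℝ≥0∞) ^ (p / 2) := by
    rw [Real.enorm_of_nonneg (Real.sqrt_nonneg _), Real.sqrt_eq_rpow,
      ← ENNReal.ofReal_rpow_of_nonneg v.coe_nonneg one_half_pos.le, ENNReal.ofReal_coe_nnreal,
      ← ENNReal.rpow_mul, one_div_mul_eq_div]
  rw [hscale, lintegral_map (by fun_prop) (by fun_prop), ← hsqrt,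
    ← lintegral_const_mul _ (by fun_prop)]
  simp only [enorm_mul, ENNReal.mul_rpow_of_nonneg _ _ hp]

theorem lintegral_enorm_rpow_gaussianReal_ne_top {p : ℝ≥0} (hp : p ≠ 0) (m : ℝ) (v : ℝ≥0) :
    ∫⁻ x, ‖x‖ₑ ^ (p : ℝ) ∂gaussianReal m v ≠ ∞ :=
  (lintegral_rpow_enorm_lt_top_of_eLpNorm_lt_top (by simpa) ENNReal.coe_ne_top
    (memLp_id_gaussianReal p).2).ne

variable {Ω : Type*} [MeasurableSpace Ω] {P : Measure Ω} {B : ℝ≥0 → Ω → ℝ}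

theorem lintegral_edist_rpow_of_isPreBrownianReal (hB : IsPreBrownianReal B P) {p : ℝ}
    (hp : 0 ≤ p) (s t : ℝ≥0) :
    ∫⁻ ω, edist (B s ω) (B t ω) ^ p ∂P =
      (∫⁻ x, ‖x‖ₑ ^ p ∂gaussianReal 0 1) * edist s t ^ (p / 2) := by
  have h := (hB.hasLaw_sub s t).lintegral_comp (f := fun x => ‖x‖ₑ ^ p) (by fun_prop)
  rw [lintegral_enorm_rpow_gaussianReal hp, mul_comm] at h
  simp only [edist_eq_enorm_sub, edist_nndist s t]
  exact h

theorem exists_isAEKolmogorovProcess_of_isPreBrownianReal (hB : IsPreBrownianReal B P) {p : ℝ≥0}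
    (hp : 0 < p) : ∃ M, IsAEKolmogorovProcess B P p (p / 2) M := by
  have hmk : ∀ t, B t =ᵐ[P] (hB.aemeasurable t).mk (B t) := fun t => (hB.aemeasurable t).ae_eq_mk
  refine ⟨(∫⁻ x, ‖x‖ₑ ^ (p : ℝ) ∂gaussianReal 0 1).toNNReal, _,
    IsKolmogorovProcess.mk_of_secondCountableTopology (fun t => (hB.aemeasurable t).measurable_mk)
      (fun s t => Eq.le ?_) hp (half_pos hp), hmk⟩
  rw [ENNReal.coe_toNNReal (lintegral_enorm_rpow_gaussianReal_ne_top hp.ne' 0 1),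
    ← lintegral_edist_rpow_of_isPreBrownianReal hB p.coe_nonneg]
  refine lintegral_congr_ae ?_
  filter_upwards [hmk s, hmk t] with ω hs ht
  rw [hs, ht]

theorem ae_exists_holderOnWith_of_isBrownianReal (hB : IsBrownianReal B P) {α : ℝ≥0} (hα : 0 < α)
    (hα₂ : α < 1 / 2) {R : ℝ≥0} (hR : R ≠ 0) :
    ∀ᵐ ω ∂P, ∃ C, HolderOnWith C α (fun t => B t ω) (Iic R) := by
  have hα₂' : (α : ℝ) < 1 / 2 := by exact_mod_cast hα₂
  obtain ⟨M, hM⟩ := exists_isAEKolmogorovProcess_of_isPreBrownianReal hB.toIsPreBrownianReal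
    (p := 2 / (1 / 2 - α)) (div_pos two_pos (tsub_pos_of_lt hα₂))
  refine ae_exists_holderOnWith_Iic hM hB.cont hα ?_ hR
  rw [NNReal.coe_div, NNReal.coe_sub hα₂.le]
  push_cast
  have := mul_div_cancel₀ (2 : ℝ) (sub_pos.2 hα₂').ne'
  linarith

end Brownian

section TwoSided

variable {b b' : ℝ≥0 → ℝ}

theorem twoSided_of_nonneg {t : ℝ} (ht : 0 ≤ t) : twoSided b b' t = b t.toNNReal := if_pos ht

theorem twoSided_of_nonpos (h₀ : b 0 = b' 0) {t : ℝ} (ht : t ≤ 0) :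
    twoSided b b' t = b' (-t).toNNReal := by
  rcases ht.lt_or_eq with h | rfl
  · exact if_neg h.not_ge
  · simp [twoSided, h₀]

theorem continuous_twoSided (hb : Continuous b) (hb' : Continuous b') (h₀ : b 0 = b' 0) :
    Continuous (twoSided b b') :=
  Continuous.if_le (by fun_prop) (by fun_prop) continuous_const continuous_id (by
    rintro x rfl
    simpa using h₀)

theorem holderOnWith_twoSided (h₀ : b 0 = b' 0) {C D α R : ℝ≥0} (hb : HolderOnWith C α b (Iic R))
    (hb' : HolderOnWith D α b' (Iic R)) :
    HolderOnWith (D + C) α (twoSided b b') (Icc (-R) R) := by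
  have hnonneg : HolderOnWith C α (twoSided b b') (Icc 0 R) := fun s hs t ht => by
    rw [twoSided_of_nonneg hs.1, twoSided_of_nonneg ht.1]
    refine hb.edist_le_of_le (Real.toNNReal_le_iff_le_coe.2 hs.2)
      (Real.toNNReal_le_iff_le_coe.2 ht.2) ?_
    simpa only [ENNReal.coe_one, one_mul] using Real.lipschitzWith_toNNReal s t
  have hnonpos : HolderOnWith D α (twoSided b b') (Icc (-R) 0) := fun s hs t ht => by
    rw [twoSided_of_nonpos h₀ hs.2, twoSided_of_nonpos h₀ ht.2, ← edist_neg_neg s t]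
    refine hb'.edist_le_of_le (Real.toNNReal_le_iff_le_coe.2 (neg_le.1 hs.1))
      (Real.toNNReal_le_iff_le_coe.2 (neg_le.1 ht.1)) ?_
    simpa only [ENNReal.coe_one, one_mul] using Real.lipschitzWith_toNNReal (-s) (-t)
  rw [← Icc_union_Icc_eq_Icc (neg_nonpos.2 R.coe_nonneg) R.coe_nonneg]
  exact holderOnWith_union hnonpos hnonneg Icc_subset_Iic_self Icc_subset_Ici_self
    (right_mem_Icc.2 (neg_nonpos.2 R.coe_nonneg)) (left_mem_Icc.2 R.coe_nonneg)

variable {Ω : Type*} [MeasurableSpace Ω] {P : Measure Ω} {B B' : ℝ≥0 → Ω → ℝ}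

theorem ae_continuous_twoSided (hB : IsBrownianReal B P) (hB' : IsBrownianReal B' P) :
    ∀ᵐ ω ∂P, Continuous (twoSided (B · ω) (B' · ω)) ∧ twoSided (B · ω) (B' · ω) 0 = 0 := by
  filter_upwards [hB.cont, hB'.cont, hB.eval_zero_ae_eq_zero, hB'.eval_zero_ae_eq_zero]
    with ω hc hc' h₀ h₀'
  refine ⟨continuous_twoSided hc hc' (h₀.trans h₀'.symm), ?_⟩
  rw [twoSided_of_nonneg le_rfl, Real.toNNReal_zero, h₀]

theorem ae_exists_holderOnWith_twoSided (hB : IsBrownianReal B P) (hB' : IsBrownianReal B' P)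
    {α R : ℝ≥0} (hα : 0 < α) (hα₂ : α < 1 / 2) (hR : R ≠ 0) :
    ∀ᵐ ω ∂P, ∃ C, HolderOnWith C α (twoSided (B · ω) (B' · ω)) (Icc (-R) R) := by
  filter_upwards [hB.eval_zero_ae_eq_zero, hB'.eval_zero_ae_eq_zero,
    ae_exists_holderOnWith_of_isBrownianReal hB hα hα₂ hR,
    ae_exists_holderOnWith_of_isBrownianReal hB' hα hα₂ hR] with ω h₀ h₀' ⟨C, hC⟩ ⟨D, hD⟩
  exact ⟨D + C, holderOnWith_twoSided (h₀.trans h₀'.symm) hC hD⟩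

/-- Exponents along a sequence increasing to `1 / 2` suffice, so that the exceptional set can be
chosen independently of `α`. -/
theorem ae_forall_exists_holderOnWith_twoSided (hB : IsBrownianReal B P)
    (hB' : IsBrownianReal B' P) {R : ℝ≥0} (hR : R ≠ 0) :
    ∀ᵐ ω ∂P, ∀ α < 1 / 2, ∃ C, HolderOnWith C α (twoSided (B · ω) (B' · ω)) (Icc (-R) R) := by
  obtain ⟨a, -, ha, hlim⟩ := exists_seq_strictMono_tendsto' (half_pos (one_pos (α := ℝ≥0)))
  filter_upwards [ae_all_iff.2 fun n =>
    ae_exists_holderOnWith_twoSided hB hB' (ha n).1 (ha n).2 hR] with ω hω α hα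
  obtain ⟨n, hn⟩ := (hlim.eventually_const_lt hα).exists
  obtain ⟨C, hC⟩ := hω n
  exact ⟨_, holderOnWith_of_le_Icc hC hn.le⟩

end TwoSided

end AllenCahn

theorem mainTheorem3_general {Ω : Type*} [MeasurableSpace Ω] {P : Measure Ω} {B B' : ℝ≥0 → Ω → ℝ}
    (hB : IsBrownianReal B P) (hB' : IsBrownianReal B' P) {W : ℝ → Ω → ℝ}
    (hW : ∀ t ω, W t ω = AllenCahn.twoSided (fun s => B s ω) (fun s => B' s ω) t)
    {ρ : ℝ → ℝ} (hρ : ContDiff ℝ 1 ρ) (hρ₀ : ∀ x, x ∉ Icc (-1) 1 → ρ x = 0) (hρ₁ : ∫ x, ρ x = 1)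
    {γ : ℝ} (hγ₀ : 0 < γ) (hγ : γ < 2 / 3) {β : ℝ} (hβ : 1 < β) {T : ℝ} (hT : 0 ≤ T) :
    ∀ᵐ ω ∂P, ∀ σ : ℝ,
      (∀ᶠ ε in 𝓝[>] (0 : ℝ),
        (∀ s ∈ Icc 0 T,
          DifferentiableAt ℝ (AllenCahn.mollified ρ γ (fun r => W r ω) ε) s ∧
          AllenCahn.HasWaveSpeed (AllenCahn.forcing ρ γ β σ (fun r => W r ω) ε s)) ∧
        IntervalIntegrable
          (fun s => ε⁻¹ * AllenCahn.waveSpeed (AllenCahn.forcing ρ γ β σ (fun r => W r ω) ε s))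
          volume 0 T) ∧
      ∀ α : ℝ≥0, α < 1 / 2 →
        AllenCahn.TendstoHolder T α
          (fun ε t => AllenCahn.c₀ * AllenCahn.Wpm ρ γ β σ (fun r => W r ω) ε t)
          (fun t => -(AllenCahn.c₀ * W t ω)) := by
  lift T to ℝ≥0 using hT
  have hsupp := AllenCahn.support_subset_ball_of_continuous hρ.continuous one_ne_zero fun x hx => by
    rw [Real.closedBall_eq_Icc, zero_sub, zero_add]
    exact not_imp_comm.1 (hρ₀ x) hx
  filter_upwards [AllenCahn.ae_continuous_twoSided hB hB',
    AllenCahn.ae_forall_exists_holderOnWith_twoSided hB hB' (R := T + 1) (by positivity)]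
    with ω ⟨hcont, hzero⟩ hholder σ
  have hpath : (fun r => W r ω) = AllenCahn.twoSided (B · ω) (B' · ω) := funext (hW · ω)
  rw [← hpath] at hcont hzero hholder
  refine ⟨AllenCahn.eventually_differentiableAt_mollified_and_hasWaveSpeed hρ hsupp hcont hγ₀.le
    (by linarith) (by linarith) T.coe_nonneg, fun α hα => ?_⟩
  obtain ⟨α', hα', hα₂'⟩ := exists_between hα
  obtain ⟨C, hC⟩ := hholder α' hα₂'
  exact AllenCahn.tendstoHolder_mul_Wpm hρ hsupp hρ₁ hcont hzero hγ₀ hγ hβ σ T.coe_nonneg hα'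
    (hα.le.trans (by norm_num)) (hC.mono (Icc_subset_Icc_left (by simp)))

theorem mainTheorem3 {Ω : Type*} [MeasurableSpace Ω] (P : Measure Ω) [IsProbabilityMeasure P]
    (B B' : ℝ≥0 → Ω → ℝ) (hB : IsBrownianReal B P) (hB' : IsBrownianReal B' P)
    (hindep : IndepFun (fun ω t => B t ω) (fun ω t => B' t ω) P)
    (W : ℝ → Ω → ℝ)
    (hW : ∀ t ω, W t ω = AllenCahn.twoSided (fun s => B s ω) (fun s => B' s ω) t)
    (ρ : ℝ → ℝ) (hρ : AllenCahn.IsMollifier ρ)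
    (γ : ℝ) (hγ₀ : 0 < γ) (hγ : γ < 2 / 3)
    (β : ℝ) (hβ₁ : 1 < β) (hβ₂ : β < 2)
    (T : ℝ) (hT : 0 < T) :
    ∀ᵐ ω ∂P, ∀ σ : ℝ, σ = 1 ∨ σ = -1 →
      (∀ᶠ ε in 𝓝[>] (0 : ℝ),
        (∀ s ∈ Icc 0 T,
          DifferentiableAt ℝ (AllenCahn.mollified ρ γ (fun r => W r ω) ε) s ∧
          AllenCahn.HasWaveSpeed (AllenCahn.forcing ρ γ β σ (fun r => W r ω) ε s)) ∧
        IntervalIntegrable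
          (fun s => ε⁻¹ * AllenCahn.waveSpeed (AllenCahn.forcing ρ γ β σ (fun r => W r ω) ε s))
          volume 0 T) ∧
      ∀ α : ℝ≥0, α < 1 / 2 →
        AllenCahn.TendstoHolder T α
          (fun ε t => AllenCahn.c₀ * AllenCahn.Wpm ρ γ β σ (fun r => W r ω) ε t)
          (fun t => -(AllenCahn.c₀ * W t ω)) :=
  (mainTheorem3_general hB hB' hW (hρ.smooth.of_le (by norm_cast)) hρ.eq_zero
    hρ.integral_eq_one hγ₀ hγ hβ₁ hT.le).mono fun _ h σ _ => h σ
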